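/- Let $(M,g)$ be a nonempty compact smooth Riemannian manifold without boundary, of dimension $n\ge 1$, with Levi-Civita connection $\nabla$. Let $(E,\tilde g)$ be a smooth Riemannian vector bundle over $M$ of rank $m\ge 2$ with projection $\pi$ and with a smooth metric connection $\tilde\nabla$. Let $E_*$ be $E$ with the zero section removed and $\Sigma=\{\xi\in E:\|\xi\|=1\}$ the unit sphere bundle. A radial graph over $\Sigma$ is a hypersurface $\mathcal Y=\{e^{u(\xi)}\xi:\xi\in\Sigma\}$ with $u\in C^\infty(\Sigma)$. Its vertical Gaussian curvature at $\eta\in\mathcal Y$ is the Gaussian curvature at $\eta$ of $\mathcal Y\cap E_{\pi(\eta)}$ as a hypersurface of the Euclidean space $E_{\pi(\eta)}$, with principal curvatures taken so that those of round spheres are positive. Let $G$ be the metric on $E$ that makes the horizontal distribution of $\tilde\nabla$ and the vertical distribution orthogonal and restricts to (the lift of) $g$ on the former and to $\tilde g$ on the latter. Let $D$ be the Sasaki connection on $TE$: for vector fields $X,Y$ on $M$ and sections $s,t$ of $E$, with horizontal lifts $X^h,Y^h$ and vertical lifts $s^v,t^v$, one has $D_{X^h}Y^h=(\nabla_XY)^h$,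 $D_{X^h}t^v=(\tilde\nabla_Xt)^v$, $D_{s^v}Y^h=0$, $D_{s^v}t^v=0$. The graph $\mathcal Y$ is convex if its second fundamental form $(A,B)\mapsto G(D_AN,B)$, with $N$ the outward $G$-unit normal, is positive semidefinite: $G(D_AN,A)\ge 0$ for every $A$ tangent to $\mathcal Y$. Two radial graphs are homothetic if one is the image of the other under $\xi\mapsto c\,\xi$ for some constant $c>0$. Let $K\in C^\infty(E_*)$ be a strictly positive function such that $K(\xi)$ depends only on $\|\xi\|$. (1) If there is a real $r>0$ with $K(r\xi)=r^{1-m}$ for all $\xi\in\Sigma$, then there is a radial graph over $\Sigma$ whose vertical Gaussian curvature is given by $K$, and it can be chosen to be convex. (2) Conversely, if there is a radial graph over $\Sigma$ whose vertical Gaussian curvature is given by $K$, then there is a real $r>0$ with $K(r\xi)=r^{1-m}$ for all $\xi\in\Sigma$. (3) If $K(r\xi)=r^{1-m}$ for all $r>0$ and all $\xi\in\Sigma$, then there are infinitely many pairwise non-homothetic radial graphs over $\Sigma$ whose vertical Gaussian curvature is given by $K$. Among them there is a convex one, and if $M$ is connected, any two convex ones are homothetic. -/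

import Mathlib

open Bundle Manifold
open scoped ContDiff

noncomputable section

/-! ### Gaussian curvature of a level hypersurface of a Euclidean space -/

section Euclidean

variable {V : Type*} [NormedAddCommGroup V] [InnerProductSpace ℝ V] [CompleteSpace V]

/-- The Gauss map of the level hypersurfaces of `f`: the unit normal field pointing towards
increasing values of `f`. -/
def gaussMap (f : V → ℝ) (p : V) : V := ‖gradient f p‖⁻¹ • gradient f p

/-- The tangent space at `p` of the level hypersurface of `f` through `p`. -/
abbrev levelTangent (f : V → ℝ) (p : V) : Submodule ℝ V := (Submodule.span ℝ {gradient f p})ᗮ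

/-- The shape operator at `p` of the level hypersurface of `f` through `p`: the differential of the
Gauss map, as an endomorphism of the tangent space. -/
def shapeOperator (f : V → ℝ) (p : V) : levelTangent f p →ₗ[ℝ] levelTangent f p :=
  ((levelTangent f p).orthogonalProjectionOnto.toLinearMap ∘ₗ
    (fderiv ℝ (gaussMap f) p).toLinearMap) ∘ₗ (levelTangent f p).subtype

/-- The Gaussian curvature at `p` of the level hypersurface of `f` through `p`: the product of its
principal curvatures. With `f` increasing outwards, spheres have positive principal curvatures. -/
def gaussCurvature (f : V → ℝ) (p : V) : ℝ := LinearMap.det (shapeOperator f p)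

end Euclidean

/-! ### The Levi-Civita connection -/

section LeviCivita

variable {EM : Type*} [NormedAddCommGroup EM] [NormedSpace ℝ EM] [FiniteDimensional ℝ EM]
  {H : Type*} [TopologicalSpace H] (I : ModelWithCorners ℝ EM H)
  {M : Type*} [TopologicalSpace M] [ChartedSpace H M] [IsManifold I ∞ M]
  [RiemannianBundle (fun x : M ↦ TangentSpace I x)]

/-- The right-hand side of the Koszul formula for `2 g(∇_X Y, Z)`. -/
def koszul (X Y Z : Π x : M, TangentSpace I x) (x : M) : ℝ :=
  mvfderiv I (fun y ↦ inner ℝ (Y y) (Z y)) x (X x)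
    + mvfderiv I (fun y ↦ inner ℝ (Z y) (X y)) x (Y x)
    - mvfderiv I (fun y ↦ inner ℝ (X y) (Y y)) x (Z x)
    + inner ℝ (VectorField.mlieBracket I X Y x) (Z x)
    - inner ℝ (VectorField.mlieBracket I Y Z x) (X x)
    - inner ℝ (VectorField.mlieBracket I X Z x) (Y x)

/-- The Levi-Civita connection `∇_X Y` at `x`: the vector with
`2 g(∇_X Y, Z) = koszul X Y Z` for all `Z`, written out in an orthonormal basis of `T_x M`. -/
def leviCivita (X Y : Π x : M, TangentSpace I x) (x : M) : TangentSpace I x :=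
  haveI : FiniteDimensional ℝ (TangentSpace I x) := inferInstanceAs (FiniteDimensional ℝ EM)
  let b := stdOrthonormalBasis ℝ (TangentSpace I x)
  ∑ i, (koszul I X Y (FiberBundle.extend EM (b i)) x / 2) • b i

end LeviCivita

/-! ### The total space of a Riemannian vector bundle with a metric connection -/

section Sasaki

variable {EM : Type*} [NormedAddCommGroup EM] [NormedSpace ℝ EM] [FiniteDimensional ℝ EM]
  {H : Type*} [TopologicalSpace H] {I : ModelWithCorners ℝ EM H}
  {M : Type*} [TopologicalSpace M] [ChartedSpace H M] [IsManifold I ∞ M]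
  [RiemannianBundle (fun x : M ↦ TangentSpace I x)]
  {F : Type*} [NormedAddCommGroup F] [NormedSpace ℝ F]
  {E : M → Type*} [TopologicalSpace (TotalSpace F E)]
  [∀ x, NormedAddCommGroup (E x)] [∀ x, InnerProductSpace ℝ (E x)]
  [FiberBundle F E]

/-- The derivative of a function on the total space in the vertical directions at `ξ`, which are
identified with the fibre through `ξ`. -/
def verticalDeriv (f : TotalSpace F E → ℝ) (ξ : TotalSpace F E) : E ξ.proj →L[ℝ] ℝ :=
  fderiv ℝ (fun y : E ξ.proj ↦ f ⟨ξ.proj, y⟩) ξ.snd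

/-- The derivative of a function on the total space at `ξ` along the horizontal lift of a vector
tangent to the base. If `σ` is a section with `σ x = ξ`, the horizontal lift of `v` at `ξ` is
`dσ(v)` minus the vertical vector `∇_v σ`. -/
def horizontalDeriv (cov : CovariantDerivative I F E) (f : TotalSpace F E → ℝ)
    (ξ : TotalSpace F E) : TangentSpace I ξ.proj →L[ℝ] ℝ :=
  mvfderiv I (fun x ↦ f ⟨x, FiberBundle.extend F ξ.snd x⟩) ξ.proj
    - (verticalDeriv f ξ).comp (cov (FiberBundle.extend F ξ.snd) ξ.proj)

/-- The differential of `f` at `ξ`. The vector `(v, s)` of `T_x M × E_x` stands for the vector of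
`T_ξ E` with horizontal part the lift of `v` and with vertical part `s`. -/
def sasakiDeriv (cov : CovariantDerivative I F E) (f : TotalSpace F E → ℝ)
    (ξ : TotalSpace F E) (A : TangentSpace I ξ.proj × E ξ.proj) : ℝ :=
  horizontalDeriv cov f ξ A.1 + verticalDeriv f ξ A.2

/-- The norm of the gradient of `f` for the metric `G` on the total space for which the horizontal
and vertical distributions are orthogonal, `π` is a Riemannian submersion and the fibres carry
their given inner product. -/
def sasakiGradNorm (cov : CovariantDerivative I F E) (f : TotalSpace F E → ℝ)
    (ξ : TotalSpace F E) : ℝ :=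
  √(‖horizontalDeriv cov f ξ‖ ^ 2 + ‖verticalDeriv f ξ‖ ^ 2)

/-- The second covariant derivative `D²f(A, B) = A(B f) - (D_A B) f` of `f` at `ξ` for the Sasaki
connection `D`. For vector fields `X`, `Y` on the base and sections `s`, `t`, with horizontal lifts
`Xʰ`, `Yʰ` and vertical lifts `sᵛ`, `tᵛ`, this connection is given by
`D_{Xʰ} Yʰ = (∇_X Y)ʰ`, `D_{Xʰ} tᵛ = (∇_X t)ᵛ`, `D_{sᵛ} Yʰ = 0`, `D_{sᵛ} tᵛ = 0`.
The four summands are the horizontal-horizontal, the horizontal-vertical, the vertical-horizontal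
and the vertical-vertical part. -/
def sasakiHessian (cov : CovariantDerivative I F E) (f : TotalSpace F E → ℝ)
    (ξ : TotalSpace F E) (A B : TangentSpace I ξ.proj × E ξ.proj) : ℝ :=
  let X : Π x : M, TangentSpace I x := FiberBundle.extend EM A.1
  let Y : Π x : M, TangentSpace I x := FiberBundle.extend EM B.1
  let t : Π x : M, E x := FiberBundle.extend F B.2
  (horizontalDeriv cov (fun η ↦ horizontalDeriv cov f η (Y η.proj)) ξ A.1
      - horizontalDeriv cov f ξ (leviCivita I X Y ξ.proj))
    + (horizontalDeriv cov (fun η ↦ verticalDeriv f η (t η.proj)) ξ A.1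
      - verticalDeriv f ξ (cov t ξ.proj A.1))
    + verticalDeriv (fun η ↦ horizontalDeriv cov f η (Y η.proj)) ξ A.2
    + verticalDeriv (fun η ↦ verticalDeriv f η (t η.proj)) ξ A.2

/-- The second fundamental form `G(D_A N, B) = D²f(A, B) / |grad f|` at `ξ` of the level
hypersurface of `f`, with unit normal `N = grad f / |grad f|`, for vectors `A`, `B` tangent to it. -/
def sasakiSecondFundamentalForm (cov : CovariantDerivative I F E) (f : TotalSpace F E → ℝ)
    (ξ : TotalSpace F E) (A B : TangentSpace I ξ.proj × E ξ.proj) : ℝ :=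
  sasakiHessian cov f ξ A B / sasakiGradNorm cov f ξ

end Sasaki

/-! ### Radial graphs over the unit sphere bundle -/

section RadialGraph

variable {M : Type*} (F : Type*) (E : M → Type*)
  [∀ x, NormedAddCommGroup (E x)] [∀ x, InnerProductSpace ℝ (E x)]

/-- The bundle with its zero section removed. -/
def puncturedBundle : Set (TotalSpace F E) := {ξ | ξ.snd ≠ 0}

/-- The unit sphere bundle. -/
def unitSphereBundle : Set (TotalSpace F E) := {ξ | ‖ξ.snd‖ = 1}

variable {F E}

/-- Multiplication by a scalar in the fibres. -/
def dilate (c : ℝ) (ξ : TotalSpace F E) : TotalSpace F E := ⟨ξ.proj, c • ξ.snd⟩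

theorem norm_dilate (c : ℝ) (ξ : TotalSpace F E) : ‖(dilate c ξ).snd‖ = |c| * ‖ξ.snd‖ :=
  norm_smul c ξ.snd

theorem dilate_dilate (c d : ℝ) (ξ : TotalSpace F E) :
    dilate c (dilate d ξ) = dilate (c * d) ξ :=
  congrArg (TotalSpace.mk ξ.proj) (smul_smul c d ξ.snd)

theorem dilate_one (ξ : TotalSpace F E) : dilate 1 ξ = ξ :=
  congrArg (TotalSpace.mk ξ.proj) (one_smul ℝ ξ.snd)

theorem dilate_mem_unitSphereBundle {ξ : TotalSpace F E} (h : ξ ∈ puncturedBundle F E) :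
    dilate ‖ξ.snd‖⁻¹ ξ ∈ unitSphereBundle F E := by
  have h' : ‖ξ.snd‖ ≠ 0 := norm_ne_zero_iff.mpr h
  rw [unitSphereBundle, Set.mem_ofPred_eq, norm_dilate, abs_inv, abs_norm, inv_mul_cancel₀ h']

open Classical in
/-- The radially constant extension to the punctured bundle of a function on the unit sphere
bundle. -/
def radialExtension (u : unitSphereBundle F E → ℝ) (ξ : TotalSpace F E) : ℝ :=
  if h : ξ ∈ puncturedBundle F E then
    u ⟨dilate ‖ξ.snd‖⁻¹ ξ, dilate_mem_unitSphereBundle h⟩ else 0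

end RadialGraph

section Fibre

theorem fibre_finiteDimensional {M : Type*} [TopologicalSpace M]
    (F : Type*) [NormedAddCommGroup F] [NormedSpace ℝ F] [FiniteDimensional ℝ F]
    (E : M → Type*) [TopologicalSpace (TotalSpace F E)]
    [∀ x, NormedAddCommGroup (E x)] [∀ x, InnerProductSpace ℝ (E x)]
    [FiberBundle F E] [VectorBundle ℝ F E] (x : M) : FiniteDimensional ℝ (E x) :=
  (((trivializationAt F E x).continuousLinearEquivAt ℝ x
    (FiberBundle.mem_baseSet_trivializationAt' x)).symm.toLinearEquiv).finiteDimensional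

theorem fibre_completeSpace {M : Type*} [TopologicalSpace M]
    (F : Type*) [NormedAddCommGroup F] [NormedSpace ℝ F] [FiniteDimensional ℝ F]
    (E : M → Type*) [TopologicalSpace (TotalSpace F E)]
    [∀ x, NormedAddCommGroup (E x)] [∀ x, InnerProductSpace ℝ (E x)]
    [FiberBundle F E] [VectorBundle ℝ F E] (x : M) : CompleteSpace (E x) :=
  haveI := fibre_finiteDimensional F E x
  FiniteDimensional.complete ℝ (E x)

end Fibre

section Graph

variable {EM : Type*} [NormedAddCommGroup EM] [NormedSpace ℝ EM]
  {H : Type*} [TopologicalSpace H] (I : ModelWithCorners ℝ EM H)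
  {M : Type*} [TopologicalSpace M] [ChartedSpace H M]
  (F : Type*) [NormedAddCommGroup F] [NormedSpace ℝ F]
  (E : M → Type*) [TopologicalSpace (TotalSpace F E)]
  [∀ x, NormedAddCommGroup (E x)] [∀ x, InnerProductSpace ℝ (E x)]
  [FiberBundle F E]

/-- A smooth radial graph `ξ ↦ exp (u ξ) ξ` over the unit sphere bundle. A function `u` on the unit
sphere bundle is smooth if and only if its radially constant extension is smooth on the punctured
bundle. -/
structure RadialGraph where
  /-- The function `u`. -/
  logRadius : unitSphereBundle F E → ℝ
  smooth : ContMDiffOn (I.prod 𝓘(ℝ, F)) 𝓘(ℝ, ℝ) ∞ (radialExtension logRadius) (puncturedBundle F E)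

end Graph

namespace RadialGraph

section Basic

variable {EM : Type*} [NormedAddCommGroup EM] [NormedSpace ℝ EM]
  {H : Type*} [TopologicalSpace H] {I : ModelWithCorners ℝ EM H}
  {M : Type*} [TopologicalSpace M] [ChartedSpace H M]
  {F : Type*} [NormedAddCommGroup F] [NormedSpace ℝ F]
  {E : M → Type*} [TopologicalSpace (TotalSpace F E)]
  [∀ x, NormedAddCommGroup (E x)] [∀ x, InnerProductSpace ℝ (E x)]
  [FiberBundle F E]

/-- The underlying hypersurface. -/
def carrier (Y : RadialGraph I F E) : Set (TotalSpace F E) :=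
  Set.range fun ξ : unitSphereBundle F E ↦ dilate (Real.exp (Y.logRadius ξ)) (ξ : TotalSpace F E)

/-- The function `‖ξ‖ exp (-u ξ)`, with `u` radially constant. It increases outwards and the graph
is its level hypersurface of value `1`. -/
def definingFunction (Y : RadialGraph I F E) (ξ : TotalSpace F E) : ℝ :=
  ‖ξ.snd‖ * Real.exp (-radialExtension Y.logRadius ξ)

theorem carrier_eq (Y : RadialGraph I F E) :
    Y.carrier = {ξ | ξ ∈ puncturedBundle F E ∧ Y.definingFunction ξ = 1} := by
  ext η
  constructor
  · rintro ⟨ξ, rfl⟩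
    have hξ : ‖(ξ : TotalSpace F E).snd‖ = 1 := ξ.2
    have h0 : (ξ : TotalSpace F E).snd ≠ 0 := by
      intro h
      simp [h] at hξ
    have hmem : dilate (Real.exp (Y.logRadius ξ)) (ξ : TotalSpace F E) ∈ puncturedBundle F E :=
      smul_ne_zero (Real.exp_ne_zero _) h0
    have hu : radialExtension Y.logRadius (dilate (Real.exp (Y.logRadius ξ)) (ξ : TotalSpace F E))
        = Y.logRadius ξ := by
      rw [radialExtension, dif_pos hmem]
      congr 1
      apply Subtype.ext
      change dilate _ (dilate _ _) = _
      rw [norm_dilate, hξ, mul_one, Real.abs_exp, dilate_dilate,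
        inv_mul_cancel₀ (Real.exp_ne_zero _), dilate_one]
    refine ⟨hmem, ?_⟩
    rw [definingFunction, hu]
    rw [norm_dilate, hξ, mul_one, Real.abs_exp, ← Real.exp_add, add_neg_cancel, Real.exp_zero]
  · rintro ⟨hη, h1⟩
    have h0 : ‖η.snd‖ ≠ 0 := norm_ne_zero_iff.mpr hη
    refine ⟨⟨dilate ‖η.snd‖⁻¹ η, dilate_mem_unitSphereBundle hη⟩, ?_⟩
    rw [definingFunction, radialExtension, dif_pos hη, Real.exp_neg,
      mul_inv_eq_one₀ (Real.exp_ne_zero _)] at h1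
    change dilate (Real.exp _) (dilate _ η) = η
    rw [← h1, dilate_dilate, mul_inv_cancel₀ h0, dilate_one]

/-- Two radial graphs are homothetic if one is the image of the other under a dilation. -/
def Homothetic (Y Z : RadialGraph I F E) : Prop :=
  ∃ c : ℝ, 0 < c ∧ Z.carrier = dilate c '' Y.carrier

end Basic

section Curvature

variable {EM : Type*} [NormedAddCommGroup EM] [NormedSpace ℝ EM]
  {H : Type*} [TopologicalSpace H] {I : ModelWithCorners ℝ EM H}
  {M : Type*} [TopologicalSpace M] [ChartedSpace H M]
  {F : Type*} [NormedAddCommGroup F] [NormedSpace ℝ F] [FiniteDimensional ℝ F]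
  {E : M → Type*} [TopologicalSpace (TotalSpace F E)]
  [∀ x, NormedAddCommGroup (E x)] [∀ x, InnerProductSpace ℝ (E x)]
  [FiberBundle F E] [VectorBundle ℝ F E]

/-- The vertical Gaussian curvature at a point `ξ` of the graph: the Gaussian curvature at `ξ` of
the part of the graph in the fibre through `ξ`, as a hypersurface of this Euclidean space. -/
def verticalGaussCurvature (Y : RadialGraph I F E) (ξ : TotalSpace F E) : ℝ :=
  haveI : CompleteSpace (E ξ.proj) := fibre_completeSpace F E ξ.proj
  gaussCurvature (fun y : E ξ.proj ↦ Y.definingFunction ⟨ξ.proj, y⟩) ξ.snd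

/-- The vertical Gaussian curvature of the graph is given by `K`. -/
def HasVerticalGaussCurvature (Y : RadialGraph I F E) (K : TotalSpace F E → ℝ) : Prop :=
  ∀ ξ ∈ Y.carrier, Y.verticalGaussCurvature ξ = K ξ

end Curvature

section Convex

variable {EM : Type*} [NormedAddCommGroup EM] [NormedSpace ℝ EM] [FiniteDimensional ℝ EM]
  {H : Type*} [TopologicalSpace H] {I : ModelWithCorners ℝ EM H}
  {M : Type*} [TopologicalSpace M] [ChartedSpace H M] [IsManifold I ∞ M]
  [RiemannianBundle (fun x : M ↦ TangentSpace I x)]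
  {F : Type*} [NormedAddCommGroup F] [NormedSpace ℝ F]
  {E : M → Type*} [TopologicalSpace (TotalSpace F E)]
  [∀ x, NormedAddCommGroup (E x)] [∀ x, InnerProductSpace ℝ (E x)]
  [FiberBundle F E]

/-- A radial graph is convex if its second fundamental form with respect to the Sasaki connection
and the outward unit normal is positive semidefinite at each of its points. -/
def IsConvex (cov : CovariantDerivative I F E) (Y : RadialGraph I F E) : Prop :=
  ∀ ξ ∈ Y.carrier, ∀ A : TangentSpace I ξ.proj × E ξ.proj,
    sasakiDeriv cov Y.definingFunction ξ A = 0 →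
      0 ≤ sasakiSecondFundamentalForm cov Y.definingFunction ξ A A

end Convex

end RadialGraph

end

/-!
A radial `K` only sees the distance to the zero section, so in each fibre the problem is one about a
single starshaped hypersurface `{f = 1}` of a Euclidean `m`-space, `f` positively homogeneous of
degree one. The key fact is a rigidity: if its Gaussian curvature at every point `p` is at least
`‖p‖ ^ (1 - m)`, that of the centred sphere through `p`, then it is a centred sphere.

Indeed the Hessian of `f ^ 2 / 2` is positive definite where a centred sphere touches the
hypersurface from inside, and it is nondegenerate everywhere because the curvature does not vanish.
The punctured space being connected, it is positive definite everywhere, so that the map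
`p ↦ ‖p‖ ν(p)`, with `ν` the Gauss map, is injective. Its Jacobian is `‖p‖ ^ m / ⟪ν, p⟫` times the
curvature where `f p = 1`, which is at least `‖p‖ / ⟪ν, p⟫ ≥ 1`. But the map preserves the norm, so
it sends punctured balls into themselves and cannot increase their volume. Hence `⟪ν, p⟫ = ‖p‖`:
the normal is radial and `f` is a multiple of the norm.

In (3), rescaling the spheres by any smooth positive function of the base point yields solutions,
and by rigidity every solution is of this form, so that it is the level set of `h(x) ‖ξ‖`.
Convexity of the graph forces the Hessian of `h` to be nonnegative, and on a compact manifold this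
makes `dh` vanish.
-/

noncomputable section

open Topology Filter

/-! ### Calculus and linear algebra -/

section Calculus

theorem nonneg_of_isLocalMin_of_hasDerivAt {q q' : ℝ → ℝ} {a b : ℝ} (hmin : IsLocalMin q a)
    (hq : ∀ᶠ t in 𝓝 a, HasDerivAt q (q' t) t) (hq' : HasDerivAt q' b a) : 0 ≤ b := by
  by_contra! hneg
  have hderiv : deriv q =ᶠ[𝓝 a] q' := hq.mono fun t ht ↦ ht.deriv
  have hsnd : deriv (deriv q) a = b := by rw [hderiv.deriv_eq, hq'.deriv]
  have hmax : IsLocalMax q a := isLocalMax_of_deriv_deriv_neg (hsnd.trans_lt hneg)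
    hmin.deriv_eq_zero hq.self_of_nhds.continuousAt
  have hconst : q =ᶠ[𝓝 a] fun _ ↦ q a := by
    filter_upwards [hmin, hmax] with t hle hge using le_antisymm hge hle
  have hzero : deriv (deriv q) a = 0 := by simpa using hconst.deriv.deriv_eq
  exact hneg.ne (hsnd.symm.trans hzero)

section NormedSpace

variable {V : Type*} [NormedAddCommGroup V] [NormedSpace ℝ V]
  {W : Type*} [NormedAddCommGroup W] [NormedSpace ℝ W]

theorem fderiv_apply_self_of_homogeneous {h : V → W} {p : V} (hd : DifferentiableAt ℝ h p) (k : ℕ)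
    (hom : ∀ c : ℝ, 0 < c → h (c • p) = c ^ k • h p) : fderiv ℝ h p p = (k : ℝ) • h p := by
  have hline : HasDerivAt (fun t : ℝ ↦ t • p) p 1 := by
    simpa using (hasDerivAt_id (1 : ℝ)).smul_const p
  have hd' : HasFDerivAt h (fderiv ℝ h p) ((1 : ℝ) • p) := by simpa using hd.hasFDerivAt
  refine (hd'.comp_hasDerivAt 1 hline).unique ?_
  have hpow : HasDerivAt (fun t : ℝ ↦ t ^ k • h p) ((k : ℝ) • h p) 1 := by
    simpa using (hasDerivAt_pow k (1 : ℝ)).smul_const (h p)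
  refine hpow.congr_of_eventuallyEq ?_
  filter_upwards [lt_mem_nhds (zero_lt_one' ℝ)] with t ht using hom t ht

theorem fderiv_smul_of_homogeneous_one {h : V → W} {c : ℝ} (hc : c ≠ 0) {p : V}
    (hcp : DifferentiableAt ℝ h (c • p)) (hp : DifferentiableAt ℝ h p)
    (hom : ∀ᶠ q in 𝓝 p, h (c • q) = c • h q) : fderiv ℝ h (c • p) = fderiv ℝ h p := by
  have hleft : HasFDerivAt (fun q ↦ h (c • q)) (fderiv ℝ h (c • p) ∘L (c • .id ℝ V)) p :=
    hcp.hasFDerivAt.comp p ((hasFDerivAt_id p).const_smul c)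
  have hright : HasFDerivAt (fun q ↦ h (c • q)) (c • fderiv ℝ h p) p :=
    (hp.hasFDerivAt.const_smul c).congr_of_eventuallyEq hom
  ext v
  have hcv := congrArg (fun L : V →L[ℝ] W ↦ L v) (hleft.unique hright)
  simp only [ContinuousLinearMap.comp_apply, smul_apply,
    ContinuousLinearMap.id_apply, map_smul] at hcv
  exact smul_right_injective W hc hcv

theorem hasDerivAt_add_smul (p v : V) (t : ℝ) : HasDerivAt (fun t : ℝ ↦ p + t • v) v t := by
  simpa using ((hasDerivAt_id t).smul_const v).const_add p

end NormedSpace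

section InnerProductSpace

variable {V : Type*} [NormedAddCommGroup V] [InnerProductSpace ℝ V]

theorem hasFDerivAt_norm_of_ne_zero {p : V} (hp : p ≠ 0) :
    HasFDerivAt (fun q : V ↦ ‖q‖) (‖p‖⁻¹ • innerSL ℝ p) p := by
  have hsq : HasFDerivAt (fun q : V ↦ ‖q‖ ^ 2) (2 • innerSL ℝ p) p :=
    (hasStrictFDerivAt_norm_sq p).hasFDerivAt
  have hsqrt := hsq.sqrt (by positivity)
  simp only [Real.sqrt_sq (norm_nonneg _)] at hsqrt
  refine hsqrt.congr_fderiv ?_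
  ext v
  simp only [one_div, mul_inv_rev, smul_apply, innerSL_apply_apply, nsmul_eq_mul, Nat.cast_ofNat,
    smul_eq_mul]
  field_simp

theorem hasDerivAt_inner_add_smul {L : V → V} {p v : V} {t : ℝ}
    (hL : DifferentiableAt ℝ L (p + t • v)) :
    HasDerivAt (fun t : ℝ ↦ inner ℝ (L (p + t • v)) v)
      (inner ℝ (fderiv ℝ L (p + t • v) v) v) t := by
  simpa using (hL.hasFDerivAt.comp_hasDerivAt t (hasDerivAt_add_smul p v t)).inner ℝ
    (hasDerivAt_const t v)

theorem inner_sub_lt_inner_sub_of_fderiv_pos {L : V → V} {p q : V} (hpq : p ≠ q)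
    (hL : ∀ y ∈ segment ℝ p q, DifferentiableAt ℝ L y)
    (hpos : ∀ y ∈ segment ℝ p q, ∀ v ≠ 0, 0 < inner ℝ (fderiv ℝ L y v) v) :
    inner ℝ (L p) (q - p) < inner ℝ (L q) (q - p) := by
  have hmem : ∀ t ∈ Set.Icc (0 : ℝ) 1, p + t • (q - p) ∈ segment ℝ p q := fun t ht ↦ by
    rw [segment_eq_image']
    exact Set.mem_image_of_mem _ ht
  have hmono : StrictMonoOn (fun t : ℝ ↦ inner ℝ (L (p + t • (q - p))) (q - p)) (Set.Icc 0 1) := by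
    refine strictMonoOn_of_deriv_pos (convex_Icc 0 1)
      (fun t ht ↦ (hasDerivAt_inner_add_smul
        (hL _ (hmem t ht))).continuousAt.continuousWithinAt) fun t ht ↦ ?_
    have ht' := hmem t (interior_subset ht)
    rw [(hasDerivAt_inner_add_smul (hL _ ht')).deriv]
    exact hpos _ ht' _ (sub_ne_zero.2 hpq.symm)
  simpa using hmono (Set.left_mem_Icc.2 zero_le_one) (Set.right_mem_Icc.2 zero_le_one) zero_lt_one

variable [CompleteSpace V]

theorem contDiffAt_gradient {g : V → ℝ} {p : V} {n m : WithTop ℕ∞} (hg : ContDiffAt ℝ n g p)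
    (hmn : m + 1 ≤ n) : ContDiffAt ℝ m (gradient g) p :=
  (InnerProductSpace.toDual ℝ V).symm.toContinuousLinearEquiv.contDiff.contDiffAt.comp p
    (hg.fderiv_right hmn)

theorem differentiableAt_gradient {g : V → ℝ} {p : V} (hg : ContDiffAt ℝ 2 g p) :
    DifferentiableAt ℝ (gradient g) p :=
  (contDiffAt_gradient (m := 1) hg (by norm_num)).differentiableAt one_ne_zero

theorem inner_fderiv_gradient {g : V → ℝ} {p : V} (hg : ContDiffAt ℝ 2 g p) (v w : V) :
    inner ℝ (fderiv ℝ (gradient g) p v) w = fderiv ℝ (fderiv ℝ g) p v w := by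
  have hd : DifferentiableAt ℝ (fderiv ℝ g) p :=
    (hg.fderiv_right (m := 1) (by norm_num)).differentiableAt one_ne_zero
  have hgrad : HasFDerivAt (gradient g)
      ((InnerProductSpace.toDual ℝ V).symm.toContinuousLinearEquiv.toContinuousLinearMap ∘L
        fderiv ℝ (fderiv ℝ g) p) p :=
    ((InnerProductSpace.toDual ℝ V).symm.toContinuousLinearEquiv.hasFDerivAt).comp p hd.hasFDerivAt
  rw [hgrad.fderiv]
  exact InnerProductSpace.toDual_symm_apply

theorem isSymmetric_fderiv_gradient {g : V → ℝ} {p : V} (hg : ContDiffAt ℝ 2 g p) :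
    (fderiv ℝ (gradient g) p : V →ₗ[ℝ] V).IsSymmetric := fun v w ↦ by
  rw [ContinuousLinearMap.coe_coe, real_inner_comm _ v, inner_fderiv_gradient hg,
    inner_fderiv_gradient hg]
  exact hg.isSymmSndFDerivAt (by simp) v w

theorem hasDerivAt_comp_add_smul {g : V → ℝ} {p v : V} {t : ℝ}
    (hg : DifferentiableAt ℝ g (p + t • v)) :
    HasDerivAt (fun t : ℝ ↦ g (p + t • v)) (inner ℝ (gradient g (p + t • v)) v) t := by
  rw [inner_gradient_left]
  exact hg.hasFDerivAt.comp_hasDerivAt t (hasDerivAt_add_smul p v t)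

section Comparison

variable {g h : V → ℝ} {p : V} (heq : g p = h p) (hle : ∀ᶠ q in 𝓝 p, g q ≤ h q)

include heq hle

theorem gradient_eq_of_eventually_le (hg : DifferentiableAt ℝ g p) (hh : DifferentiableAt ℝ h p) :
    gradient g p = gradient h p := by
  have hmin : IsLocalMin (h - g) p := by
    filter_upwards [hle] with q hq
    simpa [heq] using hq
  have hzero := hmin.fderiv_eq_zero
  rw [fderiv_sub hh hg, sub_eq_zero] at hzero
  rw [gradient, gradient, hzero]

theorem inner_fderiv_gradient_le_of_eventually_le (hg : ContDiffAt ℝ 2 g p)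
    (hh : ContDiffAt ℝ 2 h p) (v : V) :
    inner ℝ (fderiv ℝ (gradient g) p v) v ≤ inner ℝ (fderiv ℝ (gradient h) p v) v := by
  have hline : Tendsto (fun t : ℝ ↦ p + t • v) (𝓝 0) (𝓝 p) := by
    simpa using (hasDerivAt_add_smul p v 0).continuousAt.tendsto
  have hmin : IsLocalMin (fun t : ℝ ↦ h (p + t • v) - g (p + t • v)) 0 := by
    filter_upwards [hline.eventually hle] with t ht
    simpa [heq] using ht
  have hderiv : ∀ᶠ t in 𝓝 (0 : ℝ), HasDerivAt (fun t : ℝ ↦ h (p + t • v) - g (p + t • v))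
      (inner ℝ (gradient h (p + t • v)) v - inner ℝ (gradient g (p + t • v)) v) t := by
    filter_upwards [hline.eventually (hg.eventually (by simp)),
      hline.eventually (hh.eventually (by simp))] with t hgt hht
    exact (hasDerivAt_comp_add_smul (hht.differentiableAt two_ne_zero)).sub
      (hasDerivAt_comp_add_smul (hgt.differentiableAt two_ne_zero))
  have hsnd : ∀ {k : V → ℝ}, ContDiffAt ℝ 2 k p → HasDerivAt
      (fun t : ℝ ↦ inner ℝ (gradient k (p + t • v)) v) (inner ℝ (fderiv ℝ (gradient k) p v) v) 0 :=
    fun {k} hk ↦ by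
      simpa using hasDerivAt_inner_add_smul (L := gradient k) (p := p) (v := v) (t := 0)
        (by simpa using differentiableAt_gradient hk)
  exact sub_nonneg.1 (nonneg_of_isLocalMin_of_hasDerivAt hmin hderiv ((hsnd hh).sub (hsnd hg)))

end Comparison

end InnerProductSpace

end Calculus

section LinearAlgebra

section Determinant

variable {K V : Type*} [Field K] [AddCommGroup V] [Module K V] [FiniteDimensional K V]

open Module

theorem det_restrict_eq_det_add_smulRight {φ : Dual K V} {T : Submodule K V}
    (hT : T = LinearMap.ker φ) {ν : V} (hν : φ ν = 1) {D : V →ₗ[K] V} (hD : φ ∘ₗ D = 0)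
    (hDT : ∀ v ∈ T, D v ∈ T) :
    LinearMap.det (D.restrict hDT) = LinearMap.det (D + φ.smulRight ν) := by
  have hφD : ∀ v, φ (D v) = 0 := LinearMap.congr_fun hD
  have hinv : T ≤ T.comap (D + φ.smulRight ν) := fun v hv ↦ by
    simp_all
  have hquot : T.mapQ T (D + φ.smulRight ν) hinv = LinearMap.id := by
    ext v
    simp only [LinearMap.comp_apply, Submodule.mkQ_apply, Submodule.mapQ_apply, LinearMap.id_apply,
      Submodule.Quotient.eq]
    simp [hT, hφD, hν]
  have hrestrict : (D + φ.smulRight ν).restrict hinv = D.restrict hDT := by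
    ext v
    have hv : φ v = 0 := LinearMap.mem_ker.1 (hT ▸ v.2)
    simp [hv]
  rw [LinearMap.det_eq_det_mul_det T _ hinv, hquot, LinearMap.det_id, mul_one, hrestrict]

theorem det_add_smulRight_of_apply_eq_zero {D : V →ₗ[K] V} {y : V} (hD : D y = 0) {φ : Dual K V}
    (hφ : φ y ≠ 0) (ψ : Dual K V) (ν : V) :
    LinearMap.det (D + ψ.smulRight ν) = ψ y / φ y * LinearMap.det (D + φ.smulRight ν) := by
  have hfactor : D + ψ.smulRight ν =
      (D + φ.smulRight ν) ∘ₗ LinearMap.transvection (ψ - φ) ((φ y)⁻¹ • y) := by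
    ext v
    have hy : (D + φ.smulRight ν) ((φ y)⁻¹ • y) = ν := by
      simp [hD, smul_smul, inv_mul_cancel₀ hφ]
    rw [LinearMap.comp_apply, LinearMap.transvection.apply, map_add, map_smul, hy]
    simp only [LinearMap.add_apply, LinearMap.smulRight_apply, LinearMap.sub_apply]
    module
  rw [hfactor, LinearMap.det_comp, LinearMap.transvection.det, mul_comm]
  congr 1
  simp only [LinearMap.sub_apply, map_smul, smul_eq_mul]
  field_simp
  ring

end Determinant

variable {V : Type*} [NormedAddCommGroup V] [InnerProductSpace ℝ V]

theorem apply_eq_zero_of_inner_self_eq_zero {B : V →ₗ[ℝ] V} (hB : B.IsSymmetric)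
    (hnonneg : ∀ v, 0 ≤ inner ℝ (B v) v) {v : V} (hv : inner ℝ (B v) v = 0) : B v = 0 := by
  have hcs := LinearMap.BilinForm.apply_mul_apply_le_of_forall_zero_le
    (innerₗ V ∘ₗ B) hnonneg v (B v)
  have hswap : inner ℝ (B (B v)) v = inner ℝ (B v) (B v) := hB (B v) v
  simp only [LinearMap.comp_apply, innerₗ_apply_apply, hv, hswap, zero_mul] at hcs
  exact inner_self_eq_zero.1 (mul_self_eq_zero.1 (hcs.antisymm (mul_self_nonneg _)))

variable [FiniteDimensional ℝ V]

theorem pow_finrank_le_det_of_isSymmetric {S : V →ₗ[ℝ] V} (hS : S.IsSymmetric) {c : ℝ} (hc : 0 ≤ c)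
    (h : ∀ v, c * ‖v‖ ^ 2 ≤ inner ℝ (S v) v) : c ^ Module.finrank ℝ V ≤ LinearMap.det S := by
  have hle : ∀ i, c ≤ hS.eigenvalues rfl i := fun i ↦ by
    simpa [hS.apply_eigenvectorBasis, inner_smul_left] using h (hS.eigenvectorBasis rfl i)
  rw [hS.det_eq_prod_eigenvalues rfl]
  calc c ^ Module.finrank ℝ V = ∏ _i : Fin (Module.finrank ℝ V), c := by simp
    _ ≤ _ := Finset.prod_le_prod (fun _ _ ↦ hc) fun i _ ↦ hle i

theorem isOpen_setOf_forall_inner_pos : IsOpen {B : V →L[ℝ] V | ∀ v ≠ 0, 0 < inner ℝ (B v) v} := by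
  rw [isOpen_iff_mem_nhds]
  intro B hB
  have hsphere : ∀ᶠ A : V →L[ℝ] V in 𝓝 B, ∀ v ∈ Metric.sphere (0 : V) 1, 0 < inner ℝ (A v) v := by
    refine (isCompact_sphere (0 : V) 1).eventually_forall_of_forall_eventually fun v hv ↦ ?_
    have hcont : Continuous fun z : (V →L[ℝ] V) × V ↦ inner ℝ (z.1 z.2) z.2 := by fun_prop
    exact hcont.continuousAt.eventually (lt_mem_nhds (hB v (ne_zero_of_mem_unit_sphere ⟨v, hv⟩)))
  filter_upwards [hsphere] with A hA v hv
  have hunit := hA (‖v‖⁻¹ • v) (by simp [norm_smul, hv])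
  rw [map_smul, real_inner_smul_left, real_inner_smul_right, ← mul_assoc] at hunit
  exact pos_of_mul_pos_right hunit (by positivity)

theorem forall_inner_pos_of_preconnectedSpace {X : Type*} [TopologicalSpace X]
    [PreconnectedSpace X] {B : X → V →L[ℝ] V} (hcont : Continuous B)
    (hsymm : ∀ x, (B x : V →ₗ[ℝ] V).IsSymmetric) (hinj : ∀ x v, B x v = 0 → v = 0) {x₀ : X}
    (h₀ : ∀ v ≠ 0, 0 < inner ℝ (B x₀ v) v) (x : X) : ∀ v ≠ 0, 0 < inner ℝ (B x v) v := by
  set P : Set X := {x | ∀ v ≠ 0, 0 < inner ℝ (B x v) v}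
  have hP : P = ⋂ v : V, {x | 0 ≤ inner ℝ (B x v) v} := by
    ext x
    simp only [P, Set.mem_iInter, Set.mem_ofPred_eq]
    refine ⟨fun h v ↦ ?_, fun h v hv ↦ ?_⟩
    · rcases eq_or_ne v 0 with rfl | hv
      · simp
      · exact (h v hv).le
    · exact (h v).lt_of_ne' fun h0 ↦
        hv (hinj x v (apply_eq_zero_of_inner_self_eq_zero (hsymm x) h h0))
  have hclosed : IsClosed P := hP ▸ isClosed_iInter fun v ↦ isClosed_le continuous_const
    ((hcont.clm_apply continuous_const).inner continuous_const)
  have hopen : IsOpen P := isOpen_setOf_forall_inner_pos.preimage hcont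
  exact Set.eq_univ_iff_forall.1 (IsClopen.eq_univ ⟨hclosed, hopen⟩ ⟨x₀, h₀⟩) x

end LinearAlgebra

/-! ### Gauges on Euclidean space -/

section Gauge

/-- A gauge of class `C²`: a function which is positive and of class `C²` off the origin and
positively homogeneous of degree one. Its level hypersurfaces are the radial graphs of class `C²`
over the unit sphere. The value at the origin is arbitrary. -/
structure IsC2Gauge {V : Type*} [NormedAddCommGroup V] [NormedSpace ℝ V] (f : V → ℝ) : Prop where
  contDiffAt : ∀ p ≠ 0, ContDiffAt ℝ 2 f p
  pos : ∀ p ≠ 0, 0 < f p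
  homog : ∀ c : ℝ, 0 < c → ∀ p ≠ 0, f (c • p) = c * f p

variable {V : Type*} [NormedAddCommGroup V] [InnerProductSpace ℝ V]

theorem isC2Gauge_const_mul_norm {c : ℝ} (hc : 0 < c) : IsC2Gauge fun p : V ↦ c * ‖p‖ where
  contDiffAt p hp := contDiffAt_const.mul (contDiffAt_norm ℝ hp)
  pos p hp := mul_pos hc (norm_pos_iff.mpr hp)
  homog a ha p _ := by rw [norm_smul, Real.norm_of_nonneg ha.le, mul_left_comm]

variable {f : V → ℝ} {p : V}

namespace IsC2Gauge

theorem differentiableAt (hf : IsC2Gauge f) (hp : p ≠ 0) : DifferentiableAt ℝ f p :=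
  (hf.contDiffAt p hp).differentiableAt two_ne_zero

theorem apply_inv_smul_self (hf : IsC2Gauge f) (hp : p ≠ 0) : f ((f p)⁻¹ • p) = 1 := by
  rw [hf.homog _ (inv_pos.2 (hf.pos p hp)) p hp, inv_mul_cancel₀ (hf.pos p hp).ne']

theorem contDiffAt_half_sq (hf : IsC2Gauge f) (hp : p ≠ 0) :
    ContDiffAt ℝ 2 (fun q ↦ f q ^ 2 / 2) p :=
  ((hf.contDiffAt p hp).pow 2).div_const 2

end IsC2Gauge

variable [CompleteSpace V]

theorem mem_levelTangent_iff (v : V) : v ∈ levelTangent f p ↔ inner ℝ (gradient f p) v = 0 :=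
  Submodule.mem_orthogonal_singleton_iff_inner_right

/-- The fundamental tensor of Finsler geometry, the Hessian of `f ^ 2 / 2`. The level hypersurfaces
of a gauge are strictly convex where it is positive definite. -/
def fundamentalTensor (f : V → ℝ) (p : V) : V →L[ℝ] V :=
  fderiv ℝ (gradient fun q ↦ f q ^ 2 / 2) p

/-- The extension of the Gauss map to a map which preserves the norm and which, for a gauge, is
positively homogeneous of degree one. -/
def radialGaussMap (f : V → ℝ) (p : V) : V := ‖p‖ • gaussMap f p

theorem gradient_half_sq (hf : DifferentiableAt ℝ f p) :
    gradient (fun q ↦ f q ^ 2 / 2) p = f p • gradient f p := by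
  refine ext_inner_right ℝ fun v ↦ ?_
  have hsq := (hf.hasFDerivAt.pow 2).mul_const (2⁻¹ : ℝ)
  simp only [← div_eq_mul_inv] at hsq
  rw [inner_gradient_left, hsq.fderiv, real_inner_smul_left, inner_gradient_left]
  simp only [Nat.add_one_sub_one, pow_one, nsmul_eq_mul, Nat.cast_ofNat, smul_apply, smul_eq_mul]
  ring

theorem gradient_const_mul_norm (c : ℝ) (hp : p ≠ 0) :
    gradient (fun q : V ↦ c * ‖q‖) p = (c * ‖p‖⁻¹) • p := by
  refine ext_inner_right ℝ fun v ↦ ?_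
  rw [inner_gradient_left, ((hasFDerivAt_norm_of_ne_zero hp).const_mul c).fderiv]
  simp [real_inner_smul_left, mul_assoc]

theorem fundamentalTensor_const_mul_norm (c : ℝ) (hp : p ≠ 0) :
    fundamentalTensor (fun q : V ↦ c * ‖q‖) p = c ^ 2 • .id ℝ V := by
  have hgrad : gradient (fun q : V ↦ (c * ‖q‖) ^ 2 / 2) =ᶠ[𝓝 p] fun q ↦ c ^ 2 • q := by
    filter_upwards [isOpen_compl_singleton.mem_nhds hp] with q hq
    rw [gradient_half_sq ((hasFDerivAt_norm_of_ne_zero hq).const_mul c).differentiableAt,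
      gradient_const_mul_norm c hq, smul_smul]
    congr 1
    field_simp [norm_ne_zero_iff.2 hq]
  exact hgrad.fderiv_eq.trans ((hasFDerivAt_id p).const_smul (c ^ 2)).fderiv

namespace IsC2Gauge

section Gradient

theorem inner_gradient_self (hf : IsC2Gauge f) (hp : p ≠ 0) : inner ℝ (gradient f p) p = f p := by
  rw [inner_gradient_left, fderiv_apply_self_of_homogeneous (hf.differentiableAt hp) 1
    fun c hc ↦ by simpa using hf.homog c hc p hp]
  simp

theorem gradient_ne_zero (hf : IsC2Gauge f) (hp : p ≠ 0) : gradient f p ≠ 0 := fun h ↦ by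
  have hinner := hf.inner_gradient_self hp
  rw [h, inner_zero_left] at hinner
  exact (hf.pos p hp).ne hinner

theorem norm_gradient_pos (hf : IsC2Gauge f) (hp : p ≠ 0) : 0 < ‖gradient f p‖ :=
  norm_pos_iff.mpr (hf.gradient_ne_zero hp)

theorem gradient_smul (hf : IsC2Gauge f) {c : ℝ} (hc : 0 < c) (hp : p ≠ 0) :
    gradient f (c • p) = gradient f p := by
  rw [gradient, gradient, fderiv_smul_of_homogeneous_one hc.ne'
    (hf.differentiableAt (smul_ne_zero hc.ne' hp)) (hf.differentiableAt hp)]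
  filter_upwards [isOpen_compl_singleton.mem_nhds hp] with q hq using hf.homog c hc q hq

theorem contDiffAt_gradient (hf : IsC2Gauge f) (hp : p ≠ 0) : ContDiffAt ℝ 1 (gradient f) p :=
  _root_.contDiffAt_gradient (hf.contDiffAt p hp) (by norm_num)

end Gradient

section GaussMap

theorem norm_gaussMap (hf : IsC2Gauge f) (hp : p ≠ 0) : ‖gaussMap f p‖ = 1 := by
  rw [gaussMap, norm_smul, norm_inv, norm_norm, inv_mul_cancel₀ (hf.norm_gradient_pos hp).ne']

theorem gradient_eq_smul_gaussMap (hf : IsC2Gauge f) (hp : p ≠ 0) :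
    gradient f p = ‖gradient f p‖ • gaussMap f p := by
  rw [gaussMap, smul_smul, mul_inv_cancel₀ (hf.norm_gradient_pos hp).ne', one_smul]

theorem inner_gaussMap_self (hf : IsC2Gauge f) (hp : p ≠ 0) :
    inner ℝ (gaussMap f p) p = f p / ‖gradient f p‖ := by
  rw [gaussMap, real_inner_smul_left, hf.inner_gradient_self hp, inv_mul_eq_div]

theorem inner_gaussMap_self_pos (hf : IsC2Gauge f) (hp : p ≠ 0) :
    0 < inner ℝ (gaussMap f p) p := by
  rw [hf.inner_gaussMap_self hp]
  exact div_pos (hf.pos p hp) (hf.norm_gradient_pos hp)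

theorem inner_gaussMap_self_le_norm (hf : IsC2Gauge f) (hp : p ≠ 0) :
    inner ℝ (gaussMap f p) p ≤ ‖p‖ := by
  simpa [hf.norm_gaussMap hp] using real_inner_le_norm (gaussMap f p) p

theorem gaussMap_smul (hf : IsC2Gauge f) {c : ℝ} (hc : 0 < c) (hp : p ≠ 0) :
    gaussMap f (c • p) = gaussMap f p := by
  rw [gaussMap, gaussMap, hf.gradient_smul hc hp]

theorem contDiffAt_gaussMap (hf : IsC2Gauge f) (hp : p ≠ 0) : ContDiffAt ℝ 1 (gaussMap f) p :=
  (((contDiffAt_norm ℝ (hf.gradient_ne_zero hp)).comp p (hf.contDiffAt_gradient hp)).inv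
    (hf.norm_gradient_pos hp).ne').smul (hf.contDiffAt_gradient hp)

theorem differentiableAt_gaussMap (hf : IsC2Gauge f) (hp : p ≠ 0) :
    DifferentiableAt ℝ (gaussMap f) p :=
  (hf.contDiffAt_gaussMap hp).differentiableAt one_ne_zero

theorem fderiv_gaussMap_self (hf : IsC2Gauge f) (hp : p ≠ 0) : fderiv ℝ (gaussMap f) p p = 0 := by
  rw [fderiv_apply_self_of_homogeneous (hf.differentiableAt_gaussMap hp) 0
    fun c hc ↦ by simpa using hf.gaussMap_smul hc hp]
  simp

theorem inner_gaussMap_fderiv_gaussMap (hf : IsC2Gauge f) (hp : p ≠ 0) (v : V) :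
    inner ℝ (gaussMap f p) (fderiv ℝ (gaussMap f) p v) = 0 := by
  have hsq : (fun q ↦ ‖gaussMap f q‖ ^ 2) =ᶠ[𝓝 p] fun _ ↦ 1 := by
    filter_upwards [isOpen_compl_singleton.mem_nhds hp] with q hq
    rw [hf.norm_gaussMap hq, one_pow]
  have hzero := (hf.differentiableAt_gaussMap hp).hasFDerivAt.norm_sq.unique
    ((hasFDerivAt_const (1 : ℝ) p).congr_of_eventuallyEq hsq)
  simpa using congrArg (fun L : V →L[ℝ] ℝ ↦ L v) hzero

theorem fderiv_gaussMap_mem_levelTangent (hf : IsC2Gauge f) (hp : p ≠ 0) (v : V) :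
    fderiv ℝ (gaussMap f) p v ∈ levelTangent f p := by
  rw [mem_levelTangent_iff, hf.gradient_eq_smul_gaussMap hp, real_inner_smul_left,
    hf.inner_gaussMap_fderiv_gaussMap hp, mul_zero]

theorem shapeOperator_eq_restrict (hf : IsC2Gauge f) (hp : p ≠ 0) :
    shapeOperator f p = (fderiv ℝ (gaussMap f) p : V →ₗ[ℝ] V).restrict
      fun v _ ↦ hf.fderiv_gaussMap_mem_levelTangent hp v := by
  ext v
  exact Submodule.starProjection_eq_self_iff.mpr (hf.fderiv_gaussMap_mem_levelTangent hp v)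

theorem hasFDerivAt_radialGaussMap (hf : IsC2Gauge f) (hp : p ≠ 0) :
    HasFDerivAt (radialGaussMap f)
      (‖p‖ • fderiv ℝ (gaussMap f) p + (‖p‖⁻¹ • innerSL ℝ p).smulRight (gaussMap f p)) p :=
  (hasFDerivAt_norm_of_ne_zero hp).smul (hf.differentiableAt_gaussMap hp).hasFDerivAt

theorem contDiffAt_radialGaussMap (hf : IsC2Gauge f) (hp : p ≠ 0) :
    ContDiffAt ℝ 1 (radialGaussMap f) p :=
  (contDiffAt_norm ℝ hp).smul (hf.contDiffAt_gaussMap hp)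

theorem norm_radialGaussMap (hf : IsC2Gauge f) (hp : p ≠ 0) : ‖radialGaussMap f p‖ = ‖p‖ := by
  rw [radialGaussMap, norm_smul, norm_norm, hf.norm_gaussMap hp, mul_one]

theorem fderiv_radialGaussMap_smul (hf : IsC2Gauge f) {c : ℝ} (hc : 0 < c) (hp : p ≠ 0) :
    fderiv ℝ (radialGaussMap f) (c • p) = fderiv ℝ (radialGaussMap f) p := by
  refine fderiv_smul_of_homogeneous_one hc.ne'
    (hf.hasFDerivAt_radialGaussMap (smul_ne_zero hc.ne' hp)).differentiableAt
    (hf.hasFDerivAt_radialGaussMap hp).differentiableAt ?_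
  filter_upwards [isOpen_compl_singleton.mem_nhds hp] with q hq
  rw [radialGaussMap, radialGaussMap, hf.gaussMap_smul hc hq, norm_smul,
    Real.norm_of_nonneg hc.le, mul_smul]

end GaussMap

section FundamentalTensor

theorem gradient_half_sq_smul (hf : IsC2Gauge f) {c : ℝ} (hc : 0 < c) (hp : p ≠ 0) :
    gradient (fun q ↦ f q ^ 2 / 2) (c • p) = c • gradient (fun q ↦ f q ^ 2 / 2) p := by
  have hcp : c • p ≠ 0 := smul_ne_zero hc.ne' hp
  rw [gradient_half_sq (hf.differentiableAt hcp), gradient_half_sq (hf.differentiableAt hp),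
    hf.homog c hc p hp, hf.gradient_smul hc hp, mul_smul]

theorem isSymmetric_fundamentalTensor (hf : IsC2Gauge f) (hp : p ≠ 0) :
    (fundamentalTensor f p : V →ₗ[ℝ] V).IsSymmetric :=
  isSymmetric_fderiv_gradient (hf.contDiffAt_half_sq hp)

theorem continuousAt_fundamentalTensor (hf : IsC2Gauge f) (hp : p ≠ 0) :
    ContinuousAt (fundamentalTensor f) p :=
  ((_root_.contDiffAt_gradient (m := 1) (hf.contDiffAt_half_sq hp) (by norm_num)).fderiv_right
    (m := 0) (by norm_num)).continuousAt

theorem fundamentalTensor_apply (hf : IsC2Gauge f) (hp : p ≠ 0) (v : V) :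
    fundamentalTensor f p v =
      f p • fderiv ℝ (gradient f) p v + inner ℝ (gradient f p) v • gradient f p := by
  have hgrad : gradient (fun q ↦ f q ^ 2 / 2) =ᶠ[𝓝 p] fun q ↦ f q • gradient f q := by
    filter_upwards [isOpen_compl_singleton.mem_nhds hp] with q hq
    exact gradient_half_sq (hf.differentiableAt hq)
  have hderiv : fderiv ℝ (fun q ↦ f q • gradient f q) p = _ :=
    ((hf.differentiableAt hp).hasFDerivAt.smul
      (differentiableAt_gradient (hf.contDiffAt p hp)).hasFDerivAt).fderiv
  rw [fundamentalTensor, hgrad.fderiv_eq, hderiv, inner_gradient_left]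
  rfl

theorem fundamentalTensor_self (hf : IsC2Gauge f) (hp : p ≠ 0) :
    fundamentalTensor f p p = f p • gradient f p := by
  rw [fundamentalTensor, fderiv_apply_self_of_homogeneous
    (differentiableAt_gradient (hf.contDiffAt_half_sq hp)) 1
    fun c hc ↦ by simpa using hf.gradient_half_sq_smul hc hp,
    gradient_half_sq (hf.differentiableAt hp)]
  simp

theorem inner_fderiv_gaussMap (hf : IsC2Gauge f) (hp : p ≠ 0) {v w : V}
    (hv : v ∈ levelTangent f p) (hw : w ∈ levelTangent f p) :
    inner ℝ (fderiv ℝ (gaussMap f) p v) w =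
      (f p * ‖gradient f p‖)⁻¹ * inner ℝ (fundamentalTensor f p v) w := by
  have hscalar : DifferentiableAt ℝ (fun q ↦ ‖gradient f q‖⁻¹) p :=
    (((contDiffAt_norm ℝ (hf.gradient_ne_zero hp)).comp p (hf.contDiffAt_gradient hp)).inv
      (hf.norm_gradient_pos hp).ne').differentiableAt one_ne_zero
  have hderiv : fderiv ℝ (gaussMap f) p = _ := (hscalar.hasFDerivAt.smul
    (differentiableAt_gradient (hf.contDiffAt p hp)).hasFDerivAt).fderiv
  rw [mem_levelTangent_iff] at hv hw
  rw [hf.fundamentalTensor_apply hp, hv, hderiv]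
  have := (hf.pos p hp).ne'
  simp only [add_apply, smul_apply, ContinuousLinearMap.smulRight_apply, inner_add_left,
    real_inner_smul_left, hw, mul_zero, add_zero, mul_inv_rev, zero_smul]
  field_simp

theorem inner_shapeOperator (hf : IsC2Gauge f) (hp : p ≠ 0) (t s : levelTangent f p) :
    inner ℝ (shapeOperator f p t) s =
      (f p * ‖gradient f p‖)⁻¹ * inner ℝ (fundamentalTensor f p t) (s : V) := by
  rw [Submodule.coe_inner, hf.shapeOperator_eq_restrict hp]
  exact hf.inner_fderiv_gaussMap hp t.2 s.2

theorem isSymmetric_shapeOperator (hf : IsC2Gauge f) (hp : p ≠ 0) :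
    (shapeOperator f p).IsSymmetric := fun t s ↦ by
  rw [hf.inner_shapeOperator hp, real_inner_comm _ t, hf.inner_shapeOperator hp,
    real_inner_comm (t : V)]
  exact congrArg _ (hf.isSymmetric_fundamentalTensor hp t s)

end FundamentalTensor

section Curvature

variable [FiniteDimensional ℝ V]

theorem finrank_levelTangent (hf : IsC2Gauge f) (hp : p ≠ 0) :
    Module.finrank ℝ (levelTangent f p) = Module.finrank ℝ V - 1 := by
  have hsum := Submodule.finrank_add_finrank_orthogonal (Submodule.span ℝ {gradient f p})
  rw [finrank_span_singleton (hf.gradient_ne_zero hp)] at hsum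
  exact Nat.eq_sub_of_add_eq' hsum

theorem det_fderiv_radialGaussMap (hf : IsC2Gauge f) (hp : p ≠ 0) :
    (fderiv ℝ (radialGaussMap f) p).det =
      ‖p‖ ^ Module.finrank ℝ V / inner ℝ (gaussMap f p) p * gaussCurvature f p := by
  have hpn : ‖p‖ ≠ 0 := norm_ne_zero_iff.mpr hp
  set ν := gaussMap f p
  let D : V →ₗ[ℝ] V := fderiv ℝ (gaussMap f) p
  have hfactor : (fderiv ℝ (radialGaussMap f) p).toLinearMap =
      ‖p‖ • (D + ((‖p‖ ^ 2)⁻¹ • innerₗ V p).smulRight ν) := by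
    rw [(hf.hasFDerivAt_radialGaussMap hp).fderiv]
    ext v
    simp only [D, ν, ContinuousLinearMap.coe_coe, LinearMap.smul_apply, LinearMap.add_apply,
      LinearMap.smulRight_apply, add_apply, smul_apply, ContinuousLinearMap.smulRight_apply,
      innerSL_apply_apply, innerₗ_apply_apply, smul_eq_mul, smul_add, smul_smul, add_right_inj]
    field_simp
  have hcurv : gaussCurvature f p = LinearMap.det (D + (innerₗ V ν).smulRight ν) := by
    rw [gaussCurvature, hf.shapeOperator_eq_restrict hp]
    refine det_restrict_eq_det_add_smulRight (Submodule.ext fun v ↦ ?_) ?_ (LinearMap.ext fun v ↦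
      hf.inner_gaussMap_fderiv_gaussMap hp v) _
    · rw [mem_levelTangent_iff, hf.gradient_eq_smul_gaussMap hp, real_inner_smul_left]
      simp [(hf.norm_gradient_pos hp).ne', ν]
    · simp [ν, hf.norm_gaussMap hp]
  rw [ContinuousLinearMap.det, hfactor, LinearMap.det_smul,
    det_add_smulRight_of_apply_eq_zero (D := D) (φ := innerₗ V ν) (hf.fderiv_gaussMap_self hp)
      (hf.inner_gaussMap_self_pos hp).ne', ← hcurv]
  simp only [LinearMap.smul_apply, innerₗ_apply_apply, inner_self_eq_norm_sq_to_K,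
    Real.ringHom_apply, smul_eq_mul]
  field_simp

theorem pow_mul_gaussCurvature_smul (hf : IsC2Gauge f) {c : ℝ} (hc : 0 < c) (hp : p ≠ 0) :
    c ^ (Module.finrank ℝ V - 1) * gaussCurvature f (c • p) = gaussCurvature f p := by
  have : Nontrivial V := nontrivial_of_ne p 0 hp
  obtain ⟨k, hk⟩ : ∃ k, Module.finrank ℝ V = k + 1 :=
    Nat.exists_eq_add_one.2 Module.finrank_pos
  have hpn : ‖p‖ ≠ 0 := norm_ne_zero_iff.mpr hp
  have hν := (hf.inner_gaussMap_self_pos hp).ne'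
  have hdet := hf.det_fderiv_radialGaussMap (smul_ne_zero hc.ne' hp)
  rw [hf.fderiv_radialGaussMap_smul hc hp, hf.det_fderiv_radialGaussMap hp,
    hf.gaussMap_smul hc hp, norm_smul, Real.norm_of_nonneg hc.le, real_inner_smul_right, hk] at hdet
  rw [hk, Nat.add_sub_cancel]
  field_simp at hdet
  rw [mul_pow, pow_succ c] at hdet
  refine mul_left_cancel₀ (mul_ne_zero hc.ne' (pow_ne_zero (k + 1) hpn)) ?_
  linear_combination -hdet

theorem eq_zero_of_fundamentalTensor_eq_zero (hf : IsC2Gauge f) (hp : p ≠ 0)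
    (hK : gaussCurvature f p ≠ 0) {v : V} (hv : fundamentalTensor f p v = 0) : v = 0 := by
  have htangent : v ∈ levelTangent f p := by
    have hinner : inner ℝ (fundamentalTensor f p v) p = inner ℝ v (fundamentalTensor f p p) :=
      hf.isSymmetric_fundamentalTensor hp v p
    rw [hv, inner_zero_left, hf.fundamentalTensor_self hp, real_inner_smul_right, zero_eq_mul,
      or_iff_right (hf.pos p hp).ne', real_inner_comm] at hinner
    exact (mem_levelTangent_iff v).2 hinner
  have hker : (⟨v, htangent⟩ : levelTangent f p) ∈ LinearMap.ker (shapeOperator f p) :=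
    LinearMap.mem_ker.2 <| ext_inner_right ℝ fun s ↦ by
      rw [hf.inner_shapeOperator hp, hv, inner_zero_left, inner_zero_left, mul_zero]
  by_contra hne
  refine hK (LinearMap.det_eq_zero_iff_ker_ne_bot.2 fun hbot ↦ hne ?_)
  rw [hbot, Submodule.mem_bot] at hker
  exact congrArg Subtype.val hker

end Curvature

end IsC2Gauge

theorem gaussCurvature_congr {g : V → ℝ} (hfg : f =ᶠ[nhds p] g) :
    gaussCurvature f p = gaussCurvature g p := by
  have hgrad : gradient f =ᶠ[nhds p] gradient g := hfg.gradient
  have hmap : fderiv ℝ (gaussMap f) p = fderiv ℝ (gaussMap g) p :=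
    Filter.EventuallyEq.fderiv_eq <| hgrad.mono fun q hq ↦ by rw [gaussMap, gaussMap, hq]
  unfold gaussCurvature shapeOperator levelTangent
  rw! [hmap, hgrad.eq_of_nhds]
  rfl

theorem gaussCurvature_const_mul_norm [FiniteDimensional ℝ V] {c : ℝ} (hc : 0 < c) (hp : p ≠ 0) :
    gaussCurvature (fun q : V ↦ c * ‖q‖) p = ‖p‖⁻¹ ^ (Module.finrank ℝ V - 1) := by
  have hf := isC2Gauge_const_mul_norm (V := V) hc
  have hpn : ‖p‖ ≠ 0 := norm_ne_zero_iff.mpr hp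
  have hS : shapeOperator (fun q : V ↦ c * ‖q‖) p = ‖p‖⁻¹ • LinearMap.id := by
    refine LinearMap.ext fun t ↦ ext_inner_right ℝ fun s ↦ ?_
    rw [hf.inner_shapeOperator hp, fundamentalTensor_const_mul_norm c hp,
      gradient_const_mul_norm c hp]
    simp only [norm_smul, norm_mul, norm_inv, norm_norm, Real.norm_of_nonneg hc.le, smul_apply,
      LinearMap.smul_apply, ContinuousLinearMap.id_apply, LinearMap.id_apply, Submodule.coe_inner,
      SetLike.val_smul, real_inner_smul_left]
    field_simp
  rw [gaussCurvature, hS, LinearMap.det_smul, LinearMap.det_id, mul_one, hf.finrank_levelTangent hp]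

end Gauge

section VolumePreserving

open MeasureTheory

variable {V : Type*} [NormedAddCommGroup V] [NormedSpace ℝ V] [FiniteDimensional ℝ V]

theorem abs_det_fderiv_eq_one_of_injOn_of_mapsTo {s : Set V} (hs : IsOpen s)
    (hbdd : Bornology.IsBounded s) {φ : V → V} (hφ : ContDiffOn ℝ 1 φ s) (hinj : Set.InjOn φ s)
    (hmaps : Set.MapsTo φ s s) (hdet : ∀ x ∈ s, 1 ≤ |(fderiv ℝ φ x).det|) :
    ∀ x ∈ s, |(fderiv ℝ φ x).det| = 1 := by
  borelize V
  set μ : Measure V := Measure.addHaar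
  have hcont : ContinuousOn (fun x ↦ |(fderiv ℝ φ x).det|) s :=
    (ContinuousLinearMap.continuous_det.comp_continuousOn
      (hφ.continuousOn_fderiv_of_isOpen hs le_rfl)).abs
  have hvol : ∫⁻ x in s, ENNReal.ofReal |(fderiv ℝ φ x).det| ∂μ ≤ ∫⁻ _ in s, 1 ∂μ := by
    rw [lintegral_abs_det_fderiv_eq_addHaar_image μ hs.measurableSet (fun x hx ↦
      ((hφ.differentiableOn one_ne_zero x hx).differentiableAt
        (hs.mem_nhds hx)).hasFDerivAt.hasFDerivWithinAt) hinj, setLIntegral_one]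
    exact measure_mono hmaps.image_subset
  have hle : (fun _ ↦ 1) ≤ᵐ[μ.restrict s] fun x ↦ ENNReal.ofReal |(fderiv ℝ φ x).det| :=
    (ae_restrict_iff' hs.measurableSet).2 <| ae_of_all _ fun x hx ↦ by simpa using hdet x hx
  have hae := ae_eq_of_ae_le_of_lintegral_le hle
    (by simpa using hbdd.measure_lt_top.ne)
    (hcont.aemeasurable hs.measurableSet).ennreal_ofReal hvol
  refine Measure.eqOn_open_of_ae_eq (μ := μ) ?_ hs hcont continuousOn_const
  filter_upwards [hae] with x hx using ENNReal.ofReal_eq_one.1 hx.symm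

end VolumePreserving

section Rigidity

variable {V : Type*} [NormedAddCommGroup V] [InnerProductSpace ℝ V] {f : V → ℝ} {p : V}

namespace IsC2Gauge

section InscribedBall

variable {c : ℝ} (hc : 0 < c) (hp : p ≠ 0) (heq : c * ‖p‖ = f p) (hle : ∀ q ≠ 0, c * ‖q‖ ≤ f q)

include hc hp heq hle

theorem norm_gradient_eq_of_forall_mul_norm_le [CompleteSpace V] (hf : IsC2Gauge f) :
    ‖gradient f p‖ = c := by
  have hev : ∀ᶠ q in 𝓝 p, c * ‖q‖ ≤ f q := by
    filter_upwards [isOpen_compl_singleton.mem_nhds hp] with q hq using hle q hq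
  rw [← gradient_eq_of_eventually_le heq hev
    ((isC2Gauge_const_mul_norm hc).differentiableAt hp) (hf.differentiableAt hp),
    gradient_const_mul_norm c hp, norm_smul, norm_mul, norm_inv, norm_norm,
    inv_mul_cancel_right₀ (norm_ne_zero_iff.2 hp), Real.norm_of_nonneg hc.le]

theorem sq_mul_norm_sq_le_inner_fundamentalTensor [CompleteSpace V] (hf : IsC2Gauge f) (v : V) :
    c ^ 2 * ‖v‖ ^ 2 ≤ inner ℝ (fundamentalTensor f p v) v := by
  have hev : ∀ᶠ q in 𝓝 p, (c * ‖q‖) ^ 2 / 2 ≤ f q ^ 2 / 2 := by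
    filter_upwards [isOpen_compl_singleton.mem_nhds hp] with q hq
    have := hle q hq
    gcongr
  have hcomp := inner_fderiv_gradient_le_of_eventually_le (by rw [heq]) hev
    ((isC2Gauge_const_mul_norm hc).contDiffAt_half_sq hp) (hf.contDiffAt_half_sq hp) v
  change inner ℝ (fundamentalTensor (fun q : V ↦ c * ‖q‖) p v) v ≤ _ at hcomp
  rwa [fundamentalTensor_const_mul_norm c hp, smul_apply, ContinuousLinearMap.id_apply,
    real_inner_smul_left, real_inner_self_eq_norm_sq] at hcomp

theorem inv_norm_pow_le_gaussCurvature [FiniteDimensional ℝ V] (hf : IsC2Gauge f) :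
    ‖p‖⁻¹ ^ (Module.finrank ℝ V - 1) ≤ gaussCurvature f p := by
  rw [gaussCurvature, ← hf.finrank_levelTangent hp]
  refine pow_finrank_le_det_of_isSymmetric (hf.isSymmetric_shapeOperator hp) (by positivity)
    fun t ↦ ?_
  rw [hf.inner_shapeOperator hp, norm_gradient_eq_of_forall_mul_norm_le hc hp heq hle hf, ← heq]
  have := norm_pos_iff.2 hp
  calc ‖p‖⁻¹ * ‖t‖ ^ 2 = (c * ‖p‖ * c)⁻¹ * (c ^ 2 * ‖(t : V)‖ ^ 2) := by
        rw [Submodule.coe_norm]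
        field_simp
    _ ≤ _ := by
        gcongr
        exact sq_mul_norm_sq_le_inner_fundamentalTensor hc hp heq hle hf t

end InscribedBall

theorem exists_mul_norm_le [ProperSpace V] [Nontrivial V] (hf : IsC2Gauge f) :
    ∃ c > 0, ∃ p ≠ 0, f p = 1 ∧ c * ‖p‖ = f p ∧ ∀ q ≠ 0, c * ‖q‖ ≤ f q := by
  have hsphere : ∀ q ∈ Metric.sphere (0 : V) 1, q ≠ 0 := fun q hq ↦
    ne_zero_of_mem_unit_sphere ⟨q, hq⟩
  obtain ⟨p, hp, hmin⟩ := (isCompact_sphere (0 : V) 1).exists_isMinOn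
    (NormedSpace.sphere_nonempty.2 zero_le_one)
    fun q hq ↦ (hf.contDiffAt q (hsphere q hq)).continuousAt.continuousWithinAt
  have hp0 := hsphere p hp
  have hfp := hf.pos p hp0
  have hpn : ‖p‖ = 1 := mem_sphere_zero_iff_norm.1 hp
  refine ⟨f p, hfp, (f p)⁻¹ • p, smul_ne_zero (inv_ne_zero hfp.ne') hp0,
    hf.apply_inv_smul_self hp0, ?_, fun q hq ↦ ?_⟩
  · rw [hf.apply_inv_smul_self hp0, norm_smul, hpn, norm_inv, Real.norm_of_nonneg hfp.le, mul_one,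
      mul_inv_cancel₀ hfp.ne']
  · have hqn := norm_pos_iff.2 hq
    have hunit : f p ≤ f (‖q‖⁻¹ • q) := hmin (by simp [norm_smul, hqn.ne'])
    rwa [hf.homog _ (inv_pos.2 hqn) q hq, inv_mul_eq_div, le_div_iff₀ hqn] at hunit

section StrictConvexity

theorem fundamentalTensor_pos [FiniteDimensional ℝ V] (hf : IsC2Gauge f)
    (hV : 1 < Module.rank ℝ V) (hK : ∀ q ≠ 0, gaussCurvature f q ≠ 0) (hp : p ≠ 0) :
    ∀ v ≠ 0, 0 < inner ℝ (fundamentalTensor f p v) v := by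
  have : Nontrivial V := nontrivial_of_ne p 0 hp
  obtain ⟨c, hc, p₀, hp₀, -, heq, hle⟩ := hf.exists_mul_norm_le
  have : PreconnectedSpace ({0}ᶜ : Set V) := isPreconnected_iff_preconnectedSpace.1
    (isConnected_compl_singleton_of_one_lt_rank hV (0 : V)).isPreconnected
  have hcont : Continuous fun q : ({0}ᶜ : Set V) ↦ fundamentalTensor f q :=
    continuous_iff_continuousAt.2 fun q ↦
      (hf.continuousAt_fundamentalTensor q.2).comp continuousAt_subtype_val
  refine forall_inner_pos_of_preconnectedSpace hcont
    (fun q ↦ hf.isSymmetric_fundamentalTensor q.2)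
    (fun q v ↦ hf.eq_zero_of_fundamentalTensor_eq_zero q.2 (hK q q.2)) (x₀ := ⟨p₀, hp₀⟩)
    (fun v hv ↦ ?_) ⟨p, hp⟩
  have := norm_pos_iff.2 hv
  exact (by positivity : 0 < c ^ 2 * ‖v‖ ^ 2).trans_le
    (sq_mul_norm_sq_le_inner_fundamentalTensor hc hp₀ heq hle hf v)

variable [CompleteSpace V] (hf : IsC2Gauge f)
  (hpos : ∀ q ≠ 0, ∀ v ≠ 0, 0 < inner ℝ (fundamentalTensor f q v) v)

include hf hpos

theorem injOn_gradient_half_sq : Set.InjOn (gradient fun q ↦ f q ^ 2 / 2) {0}ᶜ := by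
  intro p hp q hq hpq
  by_contra hne
  have hself : ∀ x ≠ 0, inner ℝ (gradient (fun q ↦ f q ^ 2 / 2) x) x = f x ^ 2 := fun x hx ↦ by
    rw [gradient_half_sq (hf.differentiableAt hx), real_inner_smul_left,
      hf.inner_gradient_self hx, sq]
  have hsegment : ∀ y ∈ segment ℝ p q, y ≠ 0 := by
    rintro _ ⟨a, b, ha, hb, hab, rfl⟩ hzero
    have hinner := congrArg (inner ℝ (gradient (fun q ↦ f q ^ 2 / 2) p)) hzero
    have hfp := hf.pos p hp
    have hfq := hf.pos q hq
    rw [inner_add_right, real_inner_smul_right, real_inner_smul_right, hself p hp, hpq,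
      hself q hq, inner_zero_right] at hinner
    rcases ha.eq_or_lt with rfl | ha
    · rw [zero_add] at hab
      simp [hab, hfq.ne'] at hinner
    · have : 0 < a * f p ^ 2 + b * f q ^ 2 := by positivity
      exact this.ne' hinner
  have hlt := inner_sub_lt_inner_sub_of_fderiv_pos hne
    (fun y hy ↦ differentiableAt_gradient (hf.contDiffAt_half_sq (hsegment y hy)))
    fun y hy ↦ hpos y (hsegment y hy)
  rw [hpq] at hlt
  exact hlt.false

theorem injOn_radialGaussMap : Set.InjOn (radialGaussMap f) {0}ᶜ := by
  intro p hp q hq hpq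
  have hnorm : ‖p‖ = ‖q‖ := by rw [← hf.norm_radialGaussMap hp, hpq, hf.norm_radialGaussMap hq]
  have hgauss : gaussMap f p = gaussMap f q := by
    rw [radialGaussMap, radialGaussMap, hnorm] at hpq
    exact smul_right_injective V (norm_ne_zero_iff.2 hq) hpq
  have hgrad : ∀ x ≠ 0, gradient (fun q ↦ f q ^ 2 / 2) x =
      (f x * ‖gradient f x‖) • gaussMap f x := fun x hx ↦ by
    rw [gradient_half_sq (hf.differentiableAt hx), mul_smul, ← hf.gradient_eq_smul_gaussMap hx]
  set a := f p * ‖gradient f p‖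
  set b := f q * ‖gradient f q‖
  have ha : 0 < a := mul_pos (hf.pos p hp) (hf.norm_gradient_pos hp)
  have hb : 0 < b := mul_pos (hf.pos q hq) (hf.norm_gradient_pos hq)
  have hray : b • p = a • q := by
    refine injOn_gradient_half_sq hf hpos (smul_ne_zero hb.ne' hp) (smul_ne_zero ha.ne' hq) ?_
    rw [hf.gradient_half_sq_smul hb hp, hf.gradient_half_sq_smul ha hq, hgrad p hp, hgrad q hq,
      hgauss, smul_comm]
  have hab : b = a := by
    have hnorms := congrArg norm hray
    rwa [norm_smul, norm_smul, hnorm, Real.norm_of_nonneg ha.le, Real.norm_of_nonneg hb.le,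
      mul_left_inj' (norm_ne_zero_iff.2 hq)] at hnorms
  rw [hab] at hray
  exact smul_right_injective V ha.ne' hray

end StrictConvexity

section CurvatureBound

variable [FiniteDimensional ℝ V]

theorem forall_inv_norm_pow_le_gaussCurvature (hf : IsC2Gauge f)
    (hK : ∀ p ≠ 0, f p = 1 → ‖p‖⁻¹ ^ (Module.finrank ℝ V - 1) ≤ gaussCurvature f p) (hp : p ≠ 0) :
    ‖p‖⁻¹ ^ (Module.finrank ℝ V - 1) ≤ gaussCurvature f p := by
  have hfp := inv_pos.2 (hf.pos p hp)
  have hlevel := hK _ (smul_ne_zero hfp.ne' hp) (hf.apply_inv_smul_self hp)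
  rw [← hf.pow_mul_gaussCurvature_smul hfp hp]
  refine le_trans (le_of_eq ?_) (mul_le_mul_of_nonneg_left hlevel (by positivity))
  rw [norm_smul, Real.norm_of_nonneg hfp.le, ← mul_pow, mul_inv, mul_inv_cancel_left₀ hfp.ne']

variable (hf : IsC2Gauge f)
  (hK : ∀ q ≠ 0, ‖q‖⁻¹ ^ (Module.finrank ℝ V - 1) ≤ gaussCurvature f q)

include hf hK

theorem norm_div_inner_gaussMap_le_det (hp : p ≠ 0) :
    ‖p‖ / inner ℝ (gaussMap f p) p ≤ (fderiv ℝ (radialGaussMap f) p).det := by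
  have : Nontrivial V := nontrivial_of_ne p 0 hp
  obtain ⟨k, hk⟩ : ∃ k, Module.finrank ℝ V = k + 1 :=
    Nat.exists_eq_add_one.2 Module.finrank_pos
  have := norm_pos_iff.2 hp
  have hν := hf.inner_gaussMap_self_pos hp
  have hKp := hK p hp
  rw [hk, Nat.add_sub_cancel] at hKp
  rw [hf.det_fderiv_radialGaussMap hp, hk]
  calc ‖p‖ / inner ℝ (gaussMap f p) p
      = ‖p‖ ^ (k + 1) / inner ℝ (gaussMap f p) p * ‖p‖⁻¹ ^ k := by
        rw [pow_succ, inv_pow]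
        field_simp
    _ ≤ _ := by gcongr

-- The radial Gauss map sends a punctured ball injectively into itself without shrinking volumes.
theorem inner_gaussMap_self_eq_norm (hV : 1 < Module.rank ℝ V) (hp : p ≠ 0) :
    inner ℝ (gaussMap f p) p = ‖p‖ := by
  have hone : ∀ q ≠ 0, 1 ≤ ‖q‖ / inner ℝ (gaussMap f q) q := fun q hq ↦
    (one_le_div (hf.inner_gaussMap_self_pos hq)).2 (hf.inner_gaussMap_self_le_norm hq)
  have hle : ∀ q ≠ 0, ‖q‖ / inner ℝ (gaussMap f q) q ≤ |(fderiv ℝ (radialGaussMap f) q).det| :=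
    fun q hq ↦ (norm_div_inner_gaussMap_le_det hf hK hq).trans (le_abs_self _)
  have hpos : ∀ q ≠ 0, ∀ v ≠ 0, 0 < inner ℝ (fundamentalTensor f q v) v := fun q hq ↦
    hf.fundamentalTensor_pos hV (fun x hx ↦
      ((pow_pos (inv_pos.2 (norm_pos_iff.2 hx)) _).trans_le (hK x hx)).ne') hq
  have hdet : |(fderiv ℝ (radialGaussMap f) p).det| = 1 := by
    refine abs_det_fderiv_eq_one_of_injOn_of_mapsTo
      (s := Metric.ball 0 (‖p‖ + 1) ∩ {0}ᶜ) (Metric.isOpen_ball.inter isOpen_compl_singleton)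
      (Metric.isBounded_ball.subset Set.inter_subset_left)
      (fun q hq ↦ (hf.contDiffAt_radialGaussMap hq.2).contDiffWithinAt)
      ((injOn_radialGaussMap hf hpos).mono Set.inter_subset_right) (fun q hq ↦ ?_)
      (fun q hq ↦ (hone q hq.2).trans (hle q hq.2)) p ⟨by simp, hp⟩
    have hnorm := hf.norm_radialGaussMap hq.2
    exact ⟨by simpa [hnorm] using hq.1, norm_ne_zero_iff.1 (hnorm ▸ norm_ne_zero_iff.2 hq.2)⟩
  have hratio := ((hle p hp).trans_eq hdet).antisymm (hone p hp)
  exact ((div_eq_one_iff_eq (hf.inner_gaussMap_self_pos hp).ne').1 hratio).symm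

end CurvatureBound

theorem hasFDerivAt_mul_inv_norm_zero [CompleteSpace V] (hf : IsC2Gauge f) (hp : p ≠ 0)
    (hν : inner ℝ (gaussMap f p) p = ‖p‖) :
    HasFDerivAt (fun q ↦ f q * ‖q‖⁻¹) (0 : V →L[ℝ] ℝ) p := by
  have hpn := norm_pos_iff.2 hp
  have hgauss : gaussMap f p = ‖p‖⁻¹ • p := by
    have hinner : inner ℝ (gaussMap f p) p = ‖gaussMap f p‖ * ‖p‖ := by
      rw [hν, hf.norm_gaussMap hp, one_mul]
    rw [inner_eq_norm_mul_iff_real, hf.norm_gaussMap hp, one_smul] at hinner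
    rw [eq_inv_smul_iff₀ hpn.ne', hinner]
  have hnorm : ‖gradient f p‖ = f p * ‖p‖⁻¹ := by
    rw [eq_mul_inv_iff_mul_eq₀ hpn.ne', ← hν, hf.inner_gaussMap_self hp,
      mul_div_cancel₀ _ (hf.norm_gradient_pos hp).ne']
  have hfderiv : fderiv ℝ f p = (f p * ‖p‖⁻¹ * ‖p‖⁻¹) • innerSL ℝ p := by
    ext v
    rw [← inner_gradient_left, hf.gradient_eq_smul_gaussMap hp, hgauss, hnorm, smul_smul,
      real_inner_smul_left]
    rfl
  refine ((hf.differentiableAt hp).hasFDerivAt.mul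
    ((hasDerivAt_inv hpn.ne').comp_hasFDerivAt p (hasFDerivAt_norm_of_ne_zero hp))).congr_fderiv ?_
  ext v
  simp only [neg_smul, smul_neg, Function.comp_apply, hfderiv, add_apply, neg_apply, smul_apply,
    coe_innerSL_apply, smul_eq_mul, zero_apply]
  field_simp
  ring

theorem exists_eq_const_mul_norm [FiniteDimensional ℝ V] (hf : IsC2Gauge f)
    (hV : 1 < Module.rank ℝ V)
    (hK : ∀ p ≠ 0, f p = 1 → ‖p‖⁻¹ ^ (Module.finrank ℝ V - 1) ≤ gaussCurvature f p) :
    ∃ c > 0, ∀ p ≠ 0, f p = c * ‖p‖ := by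
  have hzero : ∀ q ≠ 0, HasFDerivAt (fun q ↦ f q * ‖q‖⁻¹) (0 : V →L[ℝ] ℝ) q := fun q hq ↦
    hf.hasFDerivAt_mul_inv_norm_zero hq <| inner_gaussMap_self_eq_norm hf
      (fun x hx ↦ hf.forall_inv_norm_pow_le_gaussCurvature hK hx) hV hq
  have : Nontrivial V := rank_pos_iff_nontrivial.1 (zero_lt_one.trans hV)
  obtain ⟨p₀, hp₀⟩ := exists_ne (0 : V)
  refine ⟨f p₀ * ‖p₀‖⁻¹, mul_pos (hf.pos p₀ hp₀) (inv_pos.2 (norm_pos_iff.2 hp₀)), fun p hp ↦ ?_⟩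
  have hconst : f p₀ * ‖p₀‖⁻¹ = f p * ‖p‖⁻¹ := isOpen_compl_singleton.is_const_of_fderiv_eq_zero
    (isConnected_compl_singleton_of_one_lt_rank hV (0 : V)).isPreconnected
    (fun q hq ↦ (hzero q hq).differentiableAt.differentiableWithinAt)
    (fun q hq ↦ (hzero q hq).fderiv) hp₀ hp
  rw [hconst, inv_mul_cancel_right₀ (norm_ne_zero_iff.2 hp)]

/- If `k` exceeds the curvature of all centred spheres, rigidity makes the level hypersurface a
sphere. Otherwise `k` falls short of it at some radius, but not at the radius of the farthest point,
and the intermediate value theorem applies. -/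
theorem exists_apply_eq_inv_pow [FiniteDimensional ℝ V] (hf : IsC2Gauge f)
    (hV : 1 < Module.rank ℝ V) {k : ℝ → ℝ} (hk : ContinuousOn k (Set.Ioi 0))
    (hfk : ∀ p ≠ 0, f p = 1 → gaussCurvature f p = k ‖p‖) :
    ∃ r > 0, k r = r⁻¹ ^ (Module.finrank ℝ V - 1) := by
  have : Nontrivial V := rank_pos_iff_nontrivial.1 (zero_lt_one.trans hV)
  by_cases hle : ∀ r > 0, r⁻¹ ^ (Module.finrank ℝ V - 1) ≤ k r
  · obtain ⟨c, hc, hfc⟩ := hf.exists_eq_const_mul_norm hV fun p hp hfp ↦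
      hfk p hp hfp ▸ hle _ (norm_pos_iff.2 hp)
    obtain ⟨p, hp⟩ := exists_norm_eq V (inv_pos.2 hc).le
    have hp0 : p ≠ 0 := norm_pos_iff.1 (hp ▸ inv_pos.2 hc)
    refine ⟨‖p‖, norm_pos_iff.2 hp0, ?_⟩
    rw [← hfk p hp0 (by rw [hfc p hp0, hp, mul_inv_cancel₀ hc.ne']),
      ← gaussCurvature_const_mul_norm hc hp0]
    exact gaussCurvature_congr (by filter_upwards [isOpen_ne.mem_nhds hp0] using hfc)
  · push Not at hle
    obtain ⟨a, ha, hka⟩ := hle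
    obtain ⟨c, hc, p, hp, hfp, heq, hmin⟩ := hf.exists_mul_norm_le
    have hkp := inv_norm_pow_le_gaussCurvature hc hp heq hmin hf
    rw [hfk p hp hfp] at hkp
    exact isPreconnected_Ioi.intermediate_value₂ ha (norm_pos_iff.2 hp) hk
      ((continuousOn_id.inv₀ fun r hr ↦ (Set.mem_Ioi.1 hr).ne').pow _) hka.le hkp

end IsC2Gauge

end Rigidity

/-! ### Functions on Riemannian manifolds -/

section Derivative

variable {EM : Type*} [NormedAddCommGroup EM] [NormedSpace ℝ EM]
  {H : Type*} [TopologicalSpace H] {I : ModelWithCorners ℝ EM H}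
  {M : Type*} [TopologicalSpace M] [ChartedSpace H M] {ρ : M → ℝ} {x : M}

theorem mvfderiv_comp_of_hasDerivAt {g : ℝ → ℝ} {g' : ℝ} (hg : HasDerivAt g g' (ρ x))
    (hρ : MDiffAt ρ x) : mvfderiv I (fun y ↦ g (ρ y)) x = g' • mvfderiv I ρ x := by
  have hcomp : HasMFDerivAt I 𝓘(ℝ, ℝ) (fun y ↦ g (ρ y)) x _ :=
    hg.hasFDerivAt.hasMFDerivAt.comp x hρ.hasMFDerivAt
  ext v
  rw [mvfderiv, hcomp.mfderiv, smul_apply, smul_eq_mul, mul_comm]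
  rfl

theorem mvfderiv_congr {f g : M → ℝ} (h : f =ᶠ[𝓝 x] g) : mvfderiv I f x = mvfderiv I g x := by
  rw [mvfderiv, h.mfderiv_eq]
  rfl

theorem mdifferentiableAt_mvfderiv_apply [IsManifold I ∞ M] (hρ : CMDiffAt 2 ρ x)
    {Y : Π x : M, TangentSpace I x} (hY : MDiffAt (T% Y) x) :
    MDiffAt (fun y ↦ mvfderiv I ρ y (Y y)) x := by
  have hderiv := (hρ.mfderiv_const (m := 1) (by rw [one_add_one_eq_two])).mdifferentiableAt
    one_ne_zero
  have happly := MDifferentiableAt.clm_apply_of_inCoordinates (b₁ := id) (b₂ := ρ) (v := Y)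
    (ϕ := fun y ↦ mfderiv I 𝓘(ℝ, ℝ) ρ y) hderiv hY (hρ.mdifferentiableAt two_ne_zero)
  exact ((contMDiff_snd_tangentBundle_modelSpace ℝ 𝓘(ℝ, ℝ) (n := 1)).contMDiffAt.mdifferentiableAt
    one_ne_zero).comp x happly

theorem continuousAt_mvfderiv_comp_symmL [IsManifold I ∞ M] (hρ : CMDiffAt 1 ρ x) :
    ContinuousAt (fun y ↦ (mvfderiv I ρ y).comp
      ((trivializationAt EM (TangentSpace I) x).symmL ℝ y)) x := by
  convert (hρ.mfderiv_const (m := 0) (by simp)).continuousAt using 2 with y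
  ext w
  simp only [ContinuousLinearMap.comp_apply, inTangentCoordinates,
    ContinuousLinearMap.inCoordinates, TangentBundle.continuousLinearMapAt_model_space, id_eq]
  rfl

variable [I.Boundaryless]

theorem mvfderiv_eq_zero_of_isLocalMax (h : IsLocalMax ρ x) : mvfderiv I ρ x = 0 := by
  by_cases hρ : MDiffAt ρ x
  · have hderiv : HasFDerivAt (writtenInExtChartAt I 𝓘(ℝ, ℝ) x ρ) (mfderiv I 𝓘(ℝ, ℝ) ρ x)
        (extChartAt I x x) := by
      have := hρ.hasMFDerivAt.2
      rw [I.range_eq_univ] at this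
      exact hasFDerivWithinAt_univ.1 this
    have hsymm : Tendsto (extChartAt I x).symm (𝓝 (extChartAt I x x)) (𝓝 x) := by
      simpa only [ContinuousAt, extChartAt_to_inv] using continuousAt_extChartAt_symm (I := I) x
    have hmax : IsLocalMax (writtenInExtChartAt I 𝓘(ℝ, ℝ) x ρ) (extChartAt I x x) := by
      filter_upwards [hsymm.eventually h] with y hy
      change ρ ((extChartAt I x).symm y) ≤ ρ ((extChartAt I x).symm (extChartAt I x x))
      rwa [extChartAt_to_inv]
    exact hmax.hasFDerivAt_eq_zero hderiv
  · rw [mvfderiv, mfderiv_zero_of_not_mdifferentiableAt hρ]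
    rfl

theorem eventually_eq_of_mvfderiv_eq_zero [IsManifold I 1 M] (hρ : MDiff ρ)
    (h : ∀ y, mvfderiv I ρ y = 0) (x : M) : ∀ᶠ y in 𝓝 x, ρ y = ρ x := by
  have hopen : IsOpen (extChartAt I x).target := isOpen_extChartAt_target x
  obtain ⟨r, hr, hball⟩ := Metric.isOpen_iff.1 hopen _ (mem_extChartAt_target x)
  have hderiv : ∀ z ∈ Metric.ball (extChartAt I x x) r,
      HasFDerivAt (ρ ∘ (extChartAt I x).symm) (0 : EM →L[ℝ] ℝ) z := by
    intro z hz
    have hsymm : MDifferentiableAt 𝓘(ℝ, EM) I (extChartAt I x).symm z :=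
      ((contMDiffOn_extChartAt_symm (n := 1) x).contMDiffAt
        (hopen.mem_nhds (hball hz))).mdifferentiableAt one_ne_zero
    have hcomp := (hρ ((extChartAt I x).symm z)).hasMFDerivAt.comp z hsymm.hasMFDerivAt
    have hzero : mfderiv I 𝓘(ℝ, ℝ) ρ ((extChartAt I x).symm z) = 0 := h _
    rw [hzero, ContinuousLinearMap.zero_comp] at hcomp
    exact hcomp.hasFDerivAt
  have hmem := (continuousAt_extChartAt (I := I) x).eventually_mem (Metric.ball_mem_nhds _ hr)
  filter_upwards [hmem, extChartAt_source_mem_nhds (I := I) x] with y hy hys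
  have hconst := (convex_ball (extChartAt I x x) r).is_const_of_fderivWithin_eq_zero (𝕜 := ℝ)
    (f := ρ ∘ (extChartAt I x).symm)
    (fun z hz ↦ (hderiv z hz).differentiableAt.differentiableWithinAt)
    (fun z hz ↦ by rw [fderivWithin_of_isOpen Metric.isOpen_ball hz, (hderiv z hz).fderiv])
    hy (Metric.mem_ball_self hr)
  rwa [Function.comp_apply, (extChartAt I x).left_inv hys, Function.comp_apply,
    extChartAt_to_inv] at hconst

theorem eq_of_mvfderiv_eq_zero [IsManifold I 1 M] [PreconnectedSpace M] (hρ : MDiff ρ)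
    (h : ∀ x, mvfderiv I ρ x = 0) (x y : M) : ρ x = ρ y :=
  ((IsLocallyConstant.iff_eventually_eq ρ).2
    (eventually_eq_of_mvfderiv_eq_zero hρ h)).apply_eq_of_preconnectedSpace x y

end Derivative

section Sections

variable {EM : Type*} [NormedAddCommGroup EM] [NormedSpace ℝ EM]
  {H : Type*} [TopologicalSpace H] {I : ModelWithCorners ℝ EM H}
  {M : Type*} [TopologicalSpace M] [ChartedSpace H M]
  {F : Type*} [NormedAddCommGroup F] [NormedSpace ℝ F]
  {E : M → Type*} [TopologicalSpace (TotalSpace F E)]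
  [∀ x, NormedAddCommGroup (E x)] [∀ x, InnerProductSpace ℝ (E x)]
  [FiberBundle F E] [VectorBundle ℝ F E] [IsContMDiffRiemannianBundle I 1 F E]
  {σ τ : Π x, E x} {x : M}

variable (I F E) in
include I in
theorem isContinuousRiemannianBundle_of_isContMDiffRiemannianBundle :
    IsContinuousRiemannianBundle F E := by
  obtain ⟨g, hg, h⟩ :=
    IsContMDiffRiemannianBundle.exists_contMDiff (IB := I) (n := 1) (F := F) (E := E)
  exact ⟨g, hg.continuous, h⟩

theorem mvfderiv_inner_smul_right {f : M → ℝ} (hf : MDiffAt f x) (hσ : MDiffAt (T% σ) x)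
    (hτ : MDiffAt (T% τ) x) : mvfderiv I (fun y ↦ inner ℝ (σ y) ((f • τ) y)) x =
      f x • mvfderiv I (fun y ↦ inner ℝ (σ y) (τ y)) x + inner ℝ (σ x) (τ x) • mvfderiv I f x := by
  have hmul : (fun y ↦ inner ℝ (σ y) ((f • τ) y)) = fun y ↦ f y * inner ℝ (σ y) (τ y) :=
    funext fun y ↦ real_inner_smul_right _ _ _
  rw [hmul, mvfderiv_fun_mul hf (hσ.inner_bundle hτ)]

theorem mvfderiv_inner_smul_left {f : M → ℝ} (hf : MDiffAt f x) (hσ : MDiffAt (T% σ) x)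
    (hτ : MDiffAt (T% τ) x) : mvfderiv I (fun y ↦ inner ℝ ((f • σ) y) (τ y)) x =
      f x • mvfderiv I (fun y ↦ inner ℝ (σ y) (τ y)) x + inner ℝ (σ x) (τ x) • mvfderiv I f x := by
  simpa only [real_inner_comm] using mvfderiv_inner_smul_right hf hτ hσ

theorem mdifferentiableAt_norm_section (hσ : MDiffAt (T% σ) x) (hx : σ x ≠ 0) :
    MDiffAt (fun y ↦ ‖σ y‖) x := by
  simp only [norm_eq_sqrt_real_inner (F := E _)]
  exact (Real.hasDerivAt_sqrt (inner_self_ne_zero.mpr hx)).differentiableAt.mdifferentiableAt.comp x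
    (hσ.inner_bundle hσ)

theorem mvfderiv_inner_self (hσ : MDiffAt (T% σ) x) (hx : σ x ≠ 0) :
    mvfderiv I (fun y ↦ inner ℝ (σ y) (σ y)) x =
      (2 * ‖σ x‖) • mvfderiv I (fun y ↦ ‖σ y‖) x := by
  have hnorm := mdifferentiableAt_norm_section hσ hx
  simp only [real_inner_self_eq_norm_mul_norm]
  rw [mvfderiv_fun_mul hnorm hnorm, two_mul, add_smul]

theorem eventually_ne_zero_section (hσ : MDiffAt (T% σ) x) (hx : σ x ≠ 0) :
    ∀ᶠ y in 𝓝 x, σ y ≠ 0 :=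
  ((mdifferentiableAt_norm_section hσ hx).continuousAt.eventually_ne (norm_ne_zero_iff.2 hx)).mono
    fun _ ↦ norm_ne_zero_iff.1

end Sections

section Hessian

open VectorField

variable {EM : Type*} [NormedAddCommGroup EM] [NormedSpace ℝ EM]
  {H : Type*} [TopologicalSpace H] {I : ModelWithCorners ℝ EM H}
  {M : Type*} [TopologicalSpace M] [ChartedSpace H M] [IsManifold I ∞ M]
  [RiemannianBundle (fun x : M ↦ TangentSpace I x)]

variable (I) in
/-- The Hessian `X(Yh) - (∇_X Y)h` of a function `h` for the Levi-Civita connection. -/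
def hessian [FiniteDimensional ℝ EM] (h : M → ℝ) (X Y : Π x : M, TangentSpace I x) (x : M) : ℝ :=
  mvfderiv I (fun y ↦ mvfderiv I h y (Y y)) x (X x) - mvfderiv I h x (leviCivita I X Y x)

variable [IsContMDiffRiemannianBundle I 1 EM (fun x : M ↦ TangentSpace I x)]
  {X Y Z Z' : Π x : M, TangentSpace I x} {x : M}

theorem mdifferentiableAt_inner_tangent (hX : MDiffAt (T% X) x) (hY : MDiffAt (T% Y) x) :
    MDiffAt (fun y ↦ inner ℝ (X y) (Y y)) x :=
  MDifferentiableAt.inner_bundle (E := fun x : M ↦ TangentSpace I x) hX hY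

section Koszul

variable [CompleteSpace EM]

theorem koszul_add_right (hX : MDiffAt (T% X) x) (hY : MDiffAt (T% Y) x)
    (hZ : MDiffAt (T% Z) x) (hZ' : MDiffAt (T% Z') x) :
    koszul I X Y (Z + Z') x = koszul I X Y Z x + koszul I X Y Z' x := by
  have hYZ : (fun y ↦ inner ℝ (Y y) ((Z + Z') y)) =
      fun y ↦ inner ℝ (Y y) (Z y) + inner ℝ (Y y) (Z' y) := funext fun y ↦ inner_add_right _ _ _
  have hZX : (fun y ↦ inner ℝ ((Z + Z') y) (X y)) =
      fun y ↦ inner ℝ (Z y) (X y) + inner ℝ (Z' y) (X y) := funext fun y ↦ inner_add_left _ _ _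
  simp only [koszul]
  rw [hYZ, hZX, mvfderiv_fun_add (mdifferentiableAt_inner_tangent hY hZ)
    (mdifferentiableAt_inner_tangent hY hZ'),
    mvfderiv_fun_add (mdifferentiableAt_inner_tangent hZ hX)
    (mdifferentiableAt_inner_tangent hZ' hX)]
  simp only [mlieBracket_add_right hZ hZ', Pi.add_apply, map_add, inner_add_left, inner_add_right,
    _root_.add_apply]
  ring

theorem koszul_smul_right {f : M → ℝ} (hf : MDiffAt f x)
    (hX : MDiffAt (T% X) x) (hY : MDiffAt (T% Y) x) (hZ : MDiffAt (T% Z) x) :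
    koszul I X Y (f • Z) x = f x • koszul I X Y Z x := by
  have hYZ : mvfderiv I (fun y ↦ inner ℝ (Y y) ((f • Z) y)) x = _ :=
    mvfderiv_inner_smul_right (E := fun x : M ↦ TangentSpace I x) hf hY hZ
  have hZX : mvfderiv I (fun y ↦ inner ℝ ((f • Z) y) (X y)) x = _ :=
    mvfderiv_inner_smul_left (E := fun x : M ↦ TangentSpace I x) hf hZ hX
  simp only [koszul]
  rw [hYZ, hZX]
  simp only [mlieBracket_smul_right hf hZ, Pi.smul_apply', map_smul, _root_.add_apply,
    smul_apply, inner_add_left, real_inner_smul_left, real_inner_smul_right,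
    smul_eq_mul, real_inner_comm (Z x) (Y x)]
  ring

end Koszul

variable [FiniteDimensional ℝ EM]

theorem two_mul_inner_leviCivita (hX : MDiffAt (T% X) x) (hY : MDiffAt (T% Y) x)
    (hZ : MDiffAt (T% Z) x) : 2 * inner ℝ (leviCivita I X Y x) (Z x) = koszul I X Y Z x := by
  have : FiniteDimensional ℝ (TangentSpace I x) := inferInstanceAs (FiniteDimensional ℝ EM)
  have : CompleteSpace EM := FiniteDimensional.complete ℝ EM
  have htensorial : TensorialAt I EM (fun Z : Π x : M, TangentSpace I x ↦ koszul I X Y Z x) x :=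
    { smul := fun hf hZ ↦ koszul_smul_right hf hX hY hZ
      add := fun hZ hZ' ↦ koszul_add_right hX hY hZ hZ' }
  set b := stdOrthonormalBasis ℝ (TangentSpace I x)
  have hsum : leviCivita I X Y x =
      ∑ i, (koszul I X Y (FiberBundle.extend EM (b i)) x / 2) • b i := rfl
  rw [← TensorialAt.mkHom_apply htensorial hZ, hsum, sum_inner, Finset.mul_sum]
  conv_rhs => rw [← b.sum_repr' (Z x), map_sum]
  refine Finset.sum_congr rfl fun i _ ↦ ?_
  rw [map_smul, TensorialAt.mkHom_apply_eq_extend, real_inner_smul_left, smul_eq_mul]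
  ring

theorem inner_leviCivita_self (hX : MDiffAt (T% X) x) (hx : X x ≠ 0) :
    inner ℝ (X x) (leviCivita I X X x) = ‖X x‖ * mvfderiv I (fun y ↦ ‖X y‖) x (X x) := by
  have hkoszul := two_mul_inner_leviCivita hX hX hX
  have hnorm : mvfderiv I (fun y ↦ inner ℝ (X y) (X y)) x =
      (2 * ‖X x‖) • mvfderiv I (fun y ↦ ‖X y‖) x :=
    mvfderiv_inner_self (E := fun x : M ↦ TangentSpace I x) hX hx
  rw [koszul, mlieBracket_self, hnorm, real_inner_comm] at hkoszul
  simp only [smul_apply, smul_eq_mul, Pi.zero_apply, inner_zero_left] at hkoszul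
  linarith

end Hessian

section MaximumPrinciple

variable {EM : Type*} [NormedAddCommGroup EM] [NormedSpace ℝ EM]
  {H : Type*} [TopologicalSpace H] {I : ModelWithCorners ℝ EM H}
  {M : Type*} [TopologicalSpace M] [ChartedSpace H M] [IsManifold I ∞ M]
  [RiemannianBundle (fun x : M ↦ TangentSpace I x)]
  {ρ : M → ℝ} {x : M}

theorem norm_mvfderiv_le_of_mem_baseSet {y : M}
    (hy : y ∈ (trivializationAt EM (TangentSpace I) x).baseSet) :
    ‖mvfderiv I ρ y‖ ≤
      ‖(mvfderiv I ρ y).comp ((trivializationAt EM (TangentSpace I) x).symmL ℝ y) -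
          (mvfderiv I ρ x).comp ((trivializationAt EM (TangentSpace I) x).symmL ℝ x)‖ *
        ‖(trivializationAt EM (TangentSpace I) x).continuousLinearMapAt ℝ y‖ +
      ‖mvfderiv I ρ x‖ * ‖((trivializationAt EM (TangentSpace I) x).symmL ℝ x).comp
        ((trivializationAt EM (TangentSpace I) x).continuousLinearMapAt ℝ y)‖ := by
  set e := trivializationAt EM (TangentSpace I) x
  have hsplit : mvfderiv I ρ y =
      ((mvfderiv I ρ y).comp (e.symmL ℝ y) - (mvfderiv I ρ x).comp (e.symmL ℝ x)).comp
        (e.continuousLinearMapAt ℝ y) +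
      (mvfderiv I ρ x).comp ((e.symmL ℝ x).comp (e.continuousLinearMapAt ℝ y)) := by
    ext w
    simp only [ContinuousLinearMap.comp_apply, sub_apply, _root_.add_apply]
    rw [e.symmL_continuousLinearMapAt hy, sub_add_cancel]
  conv_lhs => rw [hsplit]
  exact (ContinuousLinearMap.opNorm_add_le _ _).trans
    (add_le_add (ContinuousLinearMap.opNorm_comp_le _ _) (ContinuousLinearMap.opNorm_comp_le _ _))

variable [IsContMDiffRiemannianBundle I 1 EM (fun x : M ↦ TangentSpace I x)]

theorem upperSemicontinuous_norm_mvfderiv (hρ : CMDiff 1 ρ) :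
    UpperSemicontinuous fun x ↦ ‖mvfderiv I ρ x‖ := by
  intro x c (hc : ‖mvfderiv I ρ x‖ < c)
  have := isContinuousRiemannianBundle_of_isContMDiffRiemannianBundle I EM
    (fun x : M ↦ TangentSpace I x)
  obtain ⟨C, _, hCy⟩ := eventually_norm_trivializationAt_lt EM (fun x : M ↦ TangentSpace I x) x
  obtain ⟨r, hr, hrc⟩ : ∃ r : ℝ, 1 < r ∧ ‖mvfderiv I ρ x‖ * r < c :=
    ((((continuous_const_mul ‖mvfderiv I ρ x‖).tendsto' 1 _ (mul_one _)).eventually_lt_const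
      hc).filter_mono nhdsWithin_le_nhds |>.and
      (self_mem_nhdsWithin (s := Set.Ioi (1 : ℝ)))).exists.imp fun r h ↦ ⟨h.2, h.1⟩
  have hcont := continuousAt_mvfderiv_comp_symmL (I := I) (hρ x)
  set e := trivializationAt EM (TangentSpace I) x
  set A := fun y ↦ (mvfderiv I ρ y).comp (e.symmL ℝ y)
  have hsmall : ∀ᶠ y in 𝓝 x, ‖A y - A x‖ * C + ‖mvfderiv I ρ x‖ * r < c := by
    have : ContinuousAt (fun y ↦ ‖A y - A x‖ * C + ‖mvfderiv I ρ x‖ * r) x := by fun_prop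
    exact this.eventually_lt_const (by simpa only [sub_self, norm_zero, zero_mul, zero_add])
  filter_upwards [hsmall, hCy, eventually_norm_symmL_trivializationAt_self_comp_lt EM
    (fun x : M ↦ TangentSpace I x) x hr,
    e.open_baseSet.mem_nhds (FiberBundle.mem_baseSet_trivializationAt' x)] with y hyc hyC hyr hy
  exact (norm_mvfderiv_le_of_mem_baseSet hy).trans_lt (lt_of_le_of_lt (by gcongr) hyc)

variable [FiniteDimensional ℝ EM] [I.Boundaryless]

theorem hessian_self_eq_norm_mul_mvfderiv (hρ : CMDiffAt 2 ρ x) {α : M → ℝ} (hα : MDiffAt α x)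
    (hle : ∀ᶠ y in 𝓝 x, ‖mvfderiv I ρ y‖ ≤ α y) (hx : ‖mvfderiv I ρ x‖ = α x)
    {X : Π x : M, TangentSpace I x} (hX : MDiffAt (T% X) x) (hX0 : X x ≠ 0)
    (hgrad : ∀ w, mvfderiv I ρ x w = inner ℝ (X x) w) :
    hessian I ρ X X x = ‖X x‖ * mvfderiv I α x (X x) := by
  have hαX : α x = ‖X x‖ := by
    rw [← hx, show mvfderiv I ρ x = innerSL ℝ (X x) from ContinuousLinearMap.ext hgrad]
    exact innerSL_apply_norm _ _
  have hnorm : MDiffAt (fun y ↦ ‖X y‖) x :=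
    mdifferentiableAt_norm_section (E := fun x : M ↦ TangentSpace I x) hX hX0
  have hprod : MDiffAt (fun y ↦ α y * ‖X y‖) x := hα.mul hnorm
  have hmax : IsLocalMax (fun y ↦ mvfderiv I ρ y (X y) - α y * ‖X y‖) x := by
    filter_upwards [hle] with y hy
    have hzero : mvfderiv I ρ x (X x) - α x * ‖X x‖ = 0 := by
      rw [hgrad, real_inner_self_eq_norm_mul_norm, hαX, sub_self]
    rw [hzero, sub_nonpos]
    exact (Real.le_norm_self _).trans (((mvfderiv I ρ y).le_opNorm _).trans (by gcongr))
  have hderiv := congrArg (fun L : TangentSpace I x →L[ℝ] ℝ ↦ L (X x))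
    (mvfderiv_eq_zero_of_isLocalMax hmax)
  rw [mvfderiv_fun_sub (mdifferentiableAt_mvfderiv_apply hρ hX) hprod,
    mvfderiv_fun_mul hα hnorm] at hderiv
  simp only [sub_apply, _root_.add_apply, smul_apply, smul_eq_mul, zero_apply, hαX] at hderiv
  rw [hessian, hgrad, inner_leviCivita_self hX hX0]
  linarith

theorem mvfderiv_eq_zero_of_hessian_nonneg_of_isLocalMax (hρ : CMDiffAt 2 ρ x)
    (hess : ∀ v : TangentSpace I x,
      0 ≤ hessian I ρ (FiberBundle.extend EM v) (FiberBundle.extend EM v) x)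
    {ε : ℝ} (hε : 0 < ε) (hmax : IsLocalMax (fun y ↦ ‖mvfderiv I ρ y‖ + ε * ρ y) x) :
    mvfderiv I ρ x = 0 := by
  have : FiniteDimensional ℝ (TangentSpace I x) := inferInstanceAs (FiniteDimensional ℝ EM)
  have : CompleteSpace (TangentSpace I x) := FiniteDimensional.complete ℝ _
  by_contra hne
  set v := (InnerProductSpace.toDual ℝ (TangentSpace I x)).symm (mvfderiv I ρ x)
  have hv : v ≠ 0 := by simpa [v] using hne
  have hgrad (w) : mvfderiv I ρ x w = inner ℝ v w := InnerProductSpace.toDual_symm_apply.symm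
  set c := ‖mvfderiv I ρ x‖ + ε * ρ x
  have hρx : MDiffAt ρ x := hρ.mdifferentiableAt two_ne_zero
  have hερ : MDiffAt (fun y ↦ ε * ρ y) x := mdifferentiableAt_const.mul hρx
  have hα : MDiffAt (fun y ↦ c - ε * ρ y) x := mdifferentiableAt_const.sub hερ
  have hXx : FiberBundle.extend EM v x = v := FiberBundle.extend_apply_self ..
  have hhess := hessian_self_eq_norm_mul_mvfderiv (X := FiberBundle.extend EM v) hρ hα
    (hmax.mono fun y hy ↦ le_sub_iff_add_le.2 hy) (add_sub_cancel_right _ _).symm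
    (FiberBundle.mdifferentiableAt_extend ..) (by rwa [hXx]) (by rwa [hXx])
  have hdα : mvfderiv I (fun y ↦ c - ε * ρ y) x v = -ε * ‖v‖ ^ 2 := by
    rw [mvfderiv_fun_sub mdifferentiableAt_const hερ,
      mvfderiv_fun_mul mdifferentiableAt_const hρx]
    simp [mvfderiv_const, hgrad]
  have hnonneg := hess v
  rw [hhess, hXx, hdα] at hnonneg
  have : 0 < ‖v‖ * (ε * ‖v‖ ^ 2) := by positivity
  linarith

theorem eq_of_hessian_nonneg [CompactSpace M] [PreconnectedSpace M] (hρ : CMDiff 2 ρ)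
    (hess : ∀ (x : M) (v : TangentSpace I x),
      0 ≤ hessian I ρ (FiberBundle.extend EM v) (FiberBundle.extend EM v) x) (x y : M) :
    ρ x = ρ y := by
  refine eq_of_mvfderiv_eq_zero (I := I) (hρ.mdifferentiable two_ne_zero) (fun z ↦ ?_) x y
  have : Nonempty M := ⟨z⟩
  obtain ⟨C, hC⟩ := isCompact_univ.exists_bound_of_continuousOn hρ.continuous.continuousOn
  have hsemi := upperSemicontinuous_norm_mvfderiv (hρ.of_le (m := 1) one_le_two)
  have hbound : ∀ ε > 0, ‖mvfderiv I ρ z‖ ≤ 2 * C * ε := by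
    intro ε hε
    -- At a maximum of `‖dρ‖ + ερ` where `dρ ≠ 0`, the Hessian would be negative along `grad ρ`.
    obtain ⟨q, -, hq⟩ := UpperSemicontinuousOn.exists_isMaxOn
      (f := fun y ↦ ‖mvfderiv I ρ y‖ + ε * ρ y) Set.univ_nonempty isCompact_univ
      ((hsemi.add (hρ.continuous.const_smul ε).upperSemicontinuous).upperSemicontinuousOn _)
    have hzero := mvfderiv_eq_zero_of_hessian_nonneg_of_isLocalMax (hρ q) (hess q) hε
      (Eventually.of_forall fun y ↦ hq (Set.mem_univ y))
    have hle : ‖mvfderiv I ρ z‖ + ε * ρ z ≤ ‖mvfderiv I ρ q‖ + ε * ρ q := hq (Set.mem_univ z)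
    rw [hzero, ContinuousLinearMap.opNorm_zero, zero_add] at hle
    have hosc : ρ q - ρ z ≤ 2 * C := by
      linarith [(abs_le.1 (hC z trivial)).1, (abs_le.1 (hC q trivial)).2]
    nlinarith
  have hlim : Filter.Tendsto (fun ε ↦ 2 * C * ε) (𝓝[>] 0) (𝓝 0) :=
    ((continuous_const_mul (2 * C)).tendsto' 0 0 (mul_zero _)).mono_left nhdsWithin_le_nhds
  have hnorm : ‖mvfderiv I ρ z‖ ≤ 0 :=
    ge_of_tendsto hlim (eventually_mem_nhdsWithin.mono hbound)
  ext w
  simpa using (mvfderiv I ρ z).le_of_opNorm_le hnorm w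

end MaximumPrinciple

/-! ### Radial functions on the total space -/

section Vertical

variable {M F : Type*} {E : M → Type*} [∀ x, NormedAddCommGroup (E x)]
  [∀ x, InnerProductSpace ℝ (E x)] {ξ : TotalSpace F E}

theorem verticalDeriv_congr {f g : TotalSpace F E → ℝ} (hfg : ∀ η ∈ puncturedBundle F E, f η = g η)
    (hξ : ξ ∈ puncturedBundle F E) : verticalDeriv f ξ = verticalDeriv g ξ :=
  Filter.EventuallyEq.fderiv_eq <| by
    filter_upwards [isOpen_ne.mem_nhds hξ] with y hy using hfg ⟨ξ.proj, y⟩ hy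

theorem verticalDeriv_mul_left (h : M → ℝ) (f : TotalSpace F E → ℝ) :
    verticalDeriv (fun η ↦ h η.proj * f η) ξ = h ξ.proj • verticalDeriv f ξ :=
  congrFun (fderiv_const_smul_field (f := fun y ↦ f ⟨ξ.proj, y⟩) (h ξ.proj)) ξ.snd

theorem verticalDeriv_norm (hξ : ξ ∈ puncturedBundle F E) (s : E ξ.proj) :
    verticalDeriv (fun η ↦ ‖η.snd‖) ξ s = inner ℝ ξ.snd s / ‖ξ.snd‖ := by
  rw [verticalDeriv, (hasFDerivAt_norm_of_ne_zero hξ).fderiv, smul_apply, innerSL_apply_apply,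
    smul_eq_mul, div_eq_inv_mul]

theorem verticalDeriv_inner_div_norm (t : Π x, E x) (hξ : ξ ∈ puncturedBundle F E)
    (s : E ξ.proj) : verticalDeriv (fun η ↦ inner ℝ η.snd (t η.proj) / ‖η.snd‖) ξ s =
      inner ℝ s (t ξ.proj) / ‖ξ.snd‖
        - inner ℝ ξ.snd (t ξ.proj) * inner ℝ ξ.snd s / ‖ξ.snd‖ ^ 3 := by
  have hnorm : ‖ξ.snd‖ ≠ 0 := norm_ne_zero_iff.2 hξ
  have hinner : HasFDerivAt (fun y : E ξ.proj ↦ inner ℝ y (t ξ.proj))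
      (innerSL ℝ (t ξ.proj)) ξ.snd := by
    simp only [real_inner_comm (t ξ.proj)]
    exact (innerSL ℝ (t ξ.proj)).hasFDerivAt
  have hinv := (hasDerivAt_inv hnorm).comp_hasFDerivAt ξ.snd (hasFDerivAt_norm_of_ne_zero hξ)
  have hderiv : verticalDeriv (fun η ↦ inner ℝ η.snd (t η.proj) * ‖η.snd‖⁻¹) ξ = _ :=
    (hinner.mul hinv).fderiv
  simp only [div_eq_mul_inv _ ‖_‖]
  rw [hderiv, ← real_inner_comm s]
  simp only [_root_.add_apply, smul_apply, innerSL_apply_apply, smul_eq_mul, Function.comp_apply]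
  field_simp
  ring

end Vertical

section Horizontal

variable {EM : Type*} [NormedAddCommGroup EM] [NormedSpace ℝ EM]
  {H : Type*} [TopologicalSpace H] {I : ModelWithCorners ℝ EM H}
  {M : Type*} [TopologicalSpace M] [ChartedSpace H M]
  {F : Type*} [NormedAddCommGroup F] [NormedSpace ℝ F]
  {E : M → Type*} [TopologicalSpace (TotalSpace F E)]
  [∀ x, NormedAddCommGroup (E x)] [∀ x, InnerProductSpace ℝ (E x)]
  [FiberBundle F E] {cov : CovariantDerivative I F E} {ξ : TotalSpace F E}

theorem horizontalDeriv_mul_left {h : M → ℝ} {f : TotalSpace F E → ℝ} (hh : MDiffAt h ξ.proj)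
    (hf : MDiffAt (fun x ↦ f ⟨x, FiberBundle.extend F ξ.snd x⟩) ξ.proj) :
    horizontalDeriv cov (fun η ↦ h η.proj * f η) ξ =
      f ξ • mvfderiv I h ξ.proj + h ξ.proj • horizontalDeriv cov f ξ := by
  rw [horizontalDeriv, horizontalDeriv, verticalDeriv_mul_left, mvfderiv_fun_mul hh hf,
    FiberBundle.extend_apply_self, ContinuousLinearMap.smul_comp]
  module

theorem sasakiGradNorm_pos [RiemannianBundle (fun x : M ↦ TangentSpace I x)]
    {f : TotalSpace F E → ℝ} (hf : verticalDeriv f ξ ≠ 0) : 0 < sasakiGradNorm cov f ξ := by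
  have := norm_pos_iff.2 hf
  exact Real.sqrt_pos.2 (by positivity)

variable [VectorBundle ℝ F E] [IsContMDiffRiemannianBundle I 1 F E]

theorem horizontalDeriv_congr {f g : TotalSpace F E → ℝ}
    (hfg : ∀ η ∈ puncturedBundle F E, f η = g η)
    (hξ : ξ ∈ puncturedBundle F E) : horizontalDeriv cov f ξ = horizontalDeriv cov g ξ := by
  have hne : ∀ᶠ x in 𝓝 ξ.proj, FiberBundle.extend F ξ.snd x ≠ 0 :=
    eventually_ne_zero_section (FiberBundle.mdifferentiableAt_extend I F ξ.snd)
      (by rwa [FiberBundle.extend_apply_self])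
  have hcongr : (fun x ↦ f ⟨x, FiberBundle.extend F ξ.snd x⟩) =ᶠ[𝓝 ξ.proj]
      fun x ↦ g ⟨x, FiberBundle.extend F ξ.snd x⟩ := hne.mono fun x hx ↦ hfg ⟨x, _⟩ hx
  rw [horizontalDeriv, horizontalDeriv, verticalDeriv_congr hfg hξ, mvfderiv_congr hcongr]

variable [FiniteDimensional ℝ F] [ContMDiffVectorBundle 1 F E I]

theorem mvfderiv_inner_of_isMetricCompatible (hcov : cov.IsMetricCompatible) {σ τ : Π x, E x}
    {x : M} (hσ : MDiffAt (T% σ) x) (hτ : MDiffAt (T% τ) x) (v : TangentSpace I x) :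
    mvfderiv I (fun y ↦ inner ℝ (σ y) (τ y)) x v =
      inner ℝ (cov σ x v) (τ x) + inner ℝ (σ x) (cov τ x v) := by
  classical
  simpa only [Function.update_self] using hcov.mvfderiv_inner_eq (Function.update 0 x v) hσ hτ

theorem mvfderiv_norm_of_isMetricCompatible (hcov : cov.IsMetricCompatible) {σ : Π x, E x}
    {x : M} (hσ : MDiffAt (T% σ) x) (hx : σ x ≠ 0) (v : TangentSpace I x) :
    mvfderiv I (fun y ↦ ‖σ y‖) x v = inner ℝ (σ x) (cov σ x v) / ‖σ x‖ := by
  have hinner := mvfderiv_inner_of_isMetricCompatible hcov hσ hσ v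
  rw [mvfderiv_inner_self hσ hx, smul_apply, smul_eq_mul, real_inner_comm] at hinner
  rw [eq_div_iff (norm_ne_zero_iff.2 hx)]
  linarith

theorem horizontalDeriv_norm (hcov : cov.IsMetricCompatible) (hξ : ξ ∈ puncturedBundle F E) :
    horizontalDeriv cov (fun η ↦ ‖η.snd‖) ξ = 0 := by
  ext v
  rw [horizontalDeriv, sub_apply, ContinuousLinearMap.comp_apply, verticalDeriv_norm hξ,
    mvfderiv_norm_of_isMetricCompatible hcov (FiberBundle.mdifferentiableAt_extend I F ξ.snd)
      (by rwa [FiberBundle.extend_apply_self]), FiberBundle.extend_apply_self, sub_self, zero_apply]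

theorem horizontalDeriv_inner_div_norm (hcov : cov.IsMetricCompatible) {t : Π x, E x}
    (ht : MDiffAt (T% t) ξ.proj) (hξ : ξ ∈ puncturedBundle F E) (v : TangentSpace I ξ.proj) :
    horizontalDeriv cov (fun η ↦ inner ℝ η.snd (t η.proj) / ‖η.snd‖) ξ v =
      inner ℝ ξ.snd (cov t ξ.proj v) / ‖ξ.snd‖ := by
  have hnorm : ‖ξ.snd‖ ≠ 0 := norm_ne_zero_iff.2 hξ
  set σ : Π x, E x := FiberBundle.extend F ξ.snd with hσdef
  have hσ : MDiffAt (T% σ) ξ.proj := FiberBundle.mdifferentiableAt_extend I F ξ.snd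
  have hσξ : σ ξ.proj = ξ.snd := FiberBundle.extend_apply_self ..
  have hσ0 : σ ξ.proj ≠ 0 := hσξ ▸ hξ
  have hinv : HasDerivAt (fun r : ℝ ↦ r⁻¹) _ ‖σ ξ.proj‖ := hasDerivAt_inv (norm_ne_zero_iff.2 hσ0)
  have hσnorm := mdifferentiableAt_norm_section hσ hσ0
  have hσinv : MDiffAt (fun x ↦ ‖σ x‖⁻¹) ξ.proj :=
    hinv.differentiableAt.mdifferentiableAt.comp ξ.proj hσnorm
  rw [horizontalDeriv, sub_apply, ContinuousLinearMap.comp_apply,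
    verticalDeriv_inner_div_norm t hξ]
  simp only [← hσdef, div_eq_mul_inv _ ‖σ _‖]
  rw [mvfderiv_fun_mul (hσ.inner_bundle ht) hσinv,
    mvfderiv_comp_of_hasDerivAt (ρ := fun x ↦ ‖σ x‖) hinv hσnorm]
  simp only [_root_.add_apply, smul_apply, smul_eq_mul,
    mvfderiv_inner_of_isMetricCompatible hcov hσ ht,
    mvfderiv_norm_of_isMetricCompatible hcov hσ hσ0, hσξ]
  field_simp
  ring

theorem horizontalDeriv_mul_norm (hcov : cov.IsMetricCompatible) {h : M → ℝ}
    (hh : MDiffAt h ξ.proj) (hξ : ξ ∈ puncturedBundle F E) :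
    horizontalDeriv cov (fun η ↦ h η.proj * ‖η.snd‖) ξ = ‖ξ.snd‖ • mvfderiv I h ξ.proj := by
  have hnorm := mdifferentiableAt_norm_section (FiberBundle.mdifferentiableAt_extend I F ξ.snd)
    (by rwa [FiberBundle.extend_apply_self])
  rw [horizontalDeriv_mul_left (f := fun η ↦ ‖η.snd‖) hh hnorm, horizontalDeriv_norm hcov hξ,
    smul_zero, add_zero]

theorem horizontalDeriv_mul_inner_div_norm (hcov : cov.IsMetricCompatible) {h : M → ℝ}
    (hh : MDiffAt h ξ.proj) {t : Π x, E x} (ht : MDiffAt (T% t) ξ.proj)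
    (hξ : ξ ∈ puncturedBundle F E) (v : TangentSpace I ξ.proj) :
    horizontalDeriv cov (fun η ↦ h η.proj * (inner ℝ η.snd (t η.proj) / ‖η.snd‖)) ξ v =
      mvfderiv I h ξ.proj v * (inner ℝ ξ.snd (t ξ.proj) / ‖ξ.snd‖)
        + h ξ.proj * (inner ℝ ξ.snd (cov t ξ.proj v) / ‖ξ.snd‖) := by
  have hσ := FiberBundle.mdifferentiableAt_extend I F ξ.snd
  have hσ0 : FiberBundle.extend F ξ.snd ξ.proj ≠ 0 := by rwa [FiberBundle.extend_apply_self]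
  have hf : MDiffAt (fun x ↦ inner ℝ (FiberBundle.extend F ξ.snd x) (t x) /
      ‖FiberBundle.extend F ξ.snd x‖) ξ.proj := by
    simp only [div_eq_mul_inv]
    exact (hσ.inner_bundle ht).mul ((hasDerivAt_inv
      (norm_ne_zero_iff.2 hσ0)).differentiableAt.mdifferentiableAt.comp ξ.proj
        (mdifferentiableAt_norm_section hσ hσ0))
  rw [horizontalDeriv_mul_left (f := fun η ↦ inner ℝ η.snd (t η.proj) / ‖η.snd‖) hh hf,
    _root_.add_apply, smul_apply, smul_apply, horizontalDeriv_inner_div_norm hcov ht hξ,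
    smul_eq_mul, smul_eq_mul, mul_comm]

theorem sasakiDeriv_mul_norm_smul_self (hcov : cov.IsMetricCompatible) {h : M → ℝ}
    (hh : MDiffAt h ξ.proj) (hξ : ξ ∈ puncturedBundle F E) (v : TangentSpace I ξ.proj) (a : ℝ) :
    sasakiDeriv cov (fun η ↦ h η.proj * ‖η.snd‖) ξ (v, a • ξ.snd) =
      ‖ξ.snd‖ * (mvfderiv I h ξ.proj v + a * h ξ.proj) := by
  have hnorm : ‖ξ.snd‖ ≠ 0 := norm_ne_zero_iff.2 hξ
  rw [sasakiDeriv, horizontalDeriv_mul_norm hcov hh hξ, verticalDeriv_mul_left, smul_apply,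
    smul_apply, verticalDeriv_norm hξ, real_inner_smul_right, real_inner_self_eq_norm_sq,
    smul_eq_mul, smul_eq_mul]
  field_simp

end Horizontal

section Hessian

variable {EM : Type*} [NormedAddCommGroup EM] [NormedSpace ℝ EM] [FiniteDimensional ℝ EM]
  {H : Type*} [TopologicalSpace H] {I : ModelWithCorners ℝ EM H}
  {M : Type*} [TopologicalSpace M] [ChartedSpace H M] [IsManifold I ∞ M]
  [RiemannianBundle (fun x : M ↦ TangentSpace I x)]
  {F : Type*} [NormedAddCommGroup F] [NormedSpace ℝ F]
  {E : M → Type*} [TopologicalSpace (TotalSpace F E)]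
  [∀ x, NormedAddCommGroup (E x)] [∀ x, InnerProductSpace ℝ (E x)]
  [FiberBundle F E] {cov : CovariantDerivative I F E} {ξ : TotalSpace F E}

variable [VectorBundle ℝ F E] [IsContMDiffRiemannianBundle I 1 F E]
  [FiniteDimensional ℝ F] [ContMDiffVectorBundle 1 F E I] {h : M → ℝ}

theorem sasakiHessian_mul_norm (hcov : cov.IsMetricCompatible) (hh : CMDiff 2 h)
    (hξ : ξ ∈ puncturedBundle F E) (v : TangentSpace I ξ.proj) (s : E ξ.proj) :
    sasakiHessian cov (fun η ↦ h η.proj * ‖η.snd‖) ξ (v, s) (v, s) =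
      ‖ξ.snd‖ * hessian I h (FiberBundle.extend EM v) (FiberBundle.extend EM v) ξ.proj
        + 2 * mvfderiv I h ξ.proj v * (inner ℝ ξ.snd s / ‖ξ.snd‖)
        + h ξ.proj * (‖s‖ ^ 2 / ‖ξ.snd‖ - inner ℝ ξ.snd s ^ 2 / ‖ξ.snd‖ ^ 3) := by
  have hdiff (x : M) : MDiffAt h x := (hh x).mdifferentiableAt two_ne_zero
  set X : Π x : M, TangentSpace I x := FiberBundle.extend EM v with hX
  have hXξ : X ξ.proj = v := FiberBundle.extend_apply_self ..
  have hXh : MDiffAt (fun y ↦ mvfderiv I h y (X y)) ξ.proj :=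
    mdifferentiableAt_mvfderiv_apply (hh _) (FiberBundle.mdifferentiableAt_extend ..)
  set t : Π x : M, E x := FiberBundle.extend F s with ht
  have htξ : t ξ.proj = s := FiberBundle.extend_apply_self ..
  have htdiff : MDiffAt (T% t) ξ.proj := FiberBundle.mdifferentiableAt_extend I F s
  have hhor (η) (hη : η ∈ puncturedBundle F E) :
      horizontalDeriv cov (fun η ↦ h η.proj * ‖η.snd‖) η (X η.proj) =
        mvfderiv I h η.proj (X η.proj) * ‖η.snd‖ := by
    rw [horizontalDeriv_mul_norm hcov (hdiff _) hη, smul_apply, smul_eq_mul, mul_comm]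
  have hver (η) (hη : η ∈ puncturedBundle F E) :
      verticalDeriv (fun η ↦ h η.proj * ‖η.snd‖) η (t η.proj) =
        h η.proj * (inner ℝ η.snd (t η.proj) / ‖η.snd‖) := by
    rw [verticalDeriv_mul_left, smul_apply, verticalDeriv_norm hη, smul_eq_mul]
  simp only [sasakiHessian, ← hX, ← ht]
  rw [horizontalDeriv_congr hhor hξ, horizontalDeriv_congr hver hξ, verticalDeriv_congr hhor hξ,
    verticalDeriv_congr hver hξ, horizontalDeriv_mul_norm hcov (hdiff _) hξ,
    horizontalDeriv_mul_norm hcov (h := fun y ↦ mvfderiv I h y (X y)) hXh hξ,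
    horizontalDeriv_mul_inner_div_norm hcov (hdiff _) htdiff hξ, verticalDeriv_mul_left,
    verticalDeriv_mul_left (fun y ↦ mvfderiv I h y (X y)), verticalDeriv_mul_left, hessian]
  simp only [smul_apply, smul_eq_mul, verticalDeriv_norm hξ, verticalDeriv_inner_div_norm t hξ,
    htξ, hXξ, real_inner_self_eq_norm_sq]
  ring

theorem sasakiHessian_mul_norm_smul_self (hcov : cov.IsMetricCompatible) (hh : CMDiff 2 h)
    (hξ : ξ ∈ puncturedBundle F E) (v : TangentSpace I ξ.proj) (a : ℝ) :
    sasakiHessian cov (fun η ↦ h η.proj * ‖η.snd‖) ξ (v, a • ξ.snd) (v, a • ξ.snd) =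
      ‖ξ.snd‖ * (hessian I h (FiberBundle.extend EM v) (FiberBundle.extend EM v) ξ.proj
        + 2 * a * mvfderiv I h ξ.proj v) := by
  have hnorm : ‖ξ.snd‖ ≠ 0 := norm_ne_zero_iff.2 hξ
  rw [sasakiHessian_mul_norm hcov hh hξ, real_inner_smul_right, real_inner_self_eq_norm_sq,
    norm_smul, mul_pow, Real.norm_eq_abs, sq_abs]
  field_simp
  ring

theorem sasakiHessian_const_mul_norm_nonneg (hcov : cov.IsMetricCompatible) {c : ℝ} (hc : 0 ≤ c)
    (hξ : ξ ∈ puncturedBundle F E) (A : TangentSpace I ξ.proj × E ξ.proj) :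
    0 ≤ sasakiHessian cov (fun η ↦ c * ‖η.snd‖) ξ A A := by
  have hnorm : 0 < ‖ξ.snd‖ := norm_pos_iff.2 hξ
  have hcauchy : inner ℝ ξ.snd A.2 ^ 2 ≤ (‖ξ.snd‖ * ‖A.2‖) ^ 2 :=
    sq_le_sq' (neg_le_of_abs_le (abs_real_inner_le_norm ..)) (real_inner_le_norm ..)
  rw [← Prod.mk.eta (p := A),
    sasakiHessian_mul_norm (h := fun _ ↦ c) hcov contMDiff_const hξ, hessian]
  simp only [mvfderiv_const, zero_apply, sub_zero, zero_mul, mul_zero, zero_add]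
  refine mul_nonneg hc ?_
  rw [sub_nonneg, div_le_div_iff₀ (by positivity) hnorm]
  nlinarith

end Hessian

/-! ### Radial graphs -/

section Fibres

variable {M F : Type*} {E : M → Type*} [∀ x, NormedAddCommGroup (E x)]
  [∀ x, InnerProductSpace ℝ (E x)] {K : TotalSpace F E → ℝ} {ξ : TotalSpace F E}

theorem radialExtension_dilate (u : unitSphereBundle F E → ℝ) {c : ℝ} (hc : 0 < c)
    (hξ : ξ ∈ puncturedBundle F E) : radialExtension u (dilate c ξ) = radialExtension u ξ := by
  have hcξ : dilate c ξ ∈ puncturedBundle F E := smul_ne_zero hc.ne' hξ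
  rw [radialExtension, radialExtension, dif_pos hcξ, dif_pos hξ]
  congr 2
  rw [norm_dilate, dilate_dilate, abs_of_pos hc, mul_inv, mul_right_comm, inv_mul_cancel₀ hc.ne',
    one_mul]

theorem apply_eq_of_norm_eq {r c : ℝ} (hr : 0 < r)
    (h : ∀ ξ ∈ unitSphereBundle F E, K (dilate r ξ) = c) (hξ : ‖ξ.snd‖ = r) : K ξ = c := by
  have hmem := h _ (dilate_mem_unitSphereBundle (norm_pos_iff.1 (hξ ▸ hr)))
  rwa [dilate_dilate, hξ, mul_inv_cancel₀ hr.ne', dilate_one] at hmem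

theorem apply_dilate_eq {r : ℝ} (hr : 0 < r) {k : ℝ → ℝ}
    (hk : ∀ ξ ∈ puncturedBundle F E, K ξ = k ‖ξ.snd‖) (hξ : ξ ∈ unitSphereBundle F E) :
    K (dilate r ξ) = k r := by
  have hnorm : ‖(dilate r ξ).snd‖ = r := by
    rw [norm_dilate, abs_of_pos hr, show ‖ξ.snd‖ = 1 from hξ, mul_one]
  rw [hk _ (norm_pos_iff.1 (hr.trans_eq hnorm.symm)), hnorm]

variable [TopologicalSpace M] [NormedAddCommGroup F] [TopologicalSpace (TotalSpace F E)]
  [FiberBundle F E]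

theorem continuousOn_of_forall_apply_eq_norm {x : M} [Nontrivial (E x)]
    (hK : ContinuousOn K (puncturedBundle F E)) {k : ℝ → ℝ}
    (hk : ∀ ξ ∈ puncturedBundle F E, K ξ = k ‖ξ.snd‖) : ContinuousOn k (Set.Ioi 0) := by
  obtain ⟨e, he⟩ := exists_norm_eq (E x) zero_le_one
  have hmem : ∀ r ∈ Set.Ioi (0 : ℝ), (⟨x, r • e⟩ : TotalSpace F E) ∈ puncturedBundle F E :=
    fun r hr ↦ smul_ne_zero (Set.mem_Ioi.1 hr).ne' (norm_pos_iff.1 (he ▸ one_pos))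
  have hray : Continuous fun r : ℝ ↦ (⟨x, r • e⟩ : TotalSpace F E) :=
    (FiberBundle.continuous_totalSpaceMk F E x).comp (continuous_id.smul continuous_const)
  refine (hK.comp hray.continuousOn hmem).congr fun r hr ↦ ?_
  rw [Function.comp_apply, hk _ (hmem r hr), norm_smul, he, mul_one,
    Real.norm_of_nonneg (Set.mem_Ioi.1 hr).le]

variable [NormedSpace ℝ F] [VectorBundle ℝ F E]

variable (F E) in
theorem finrank_fibre (x : M) : Module.finrank ℝ (E x) = Module.finrank ℝ F :=
  ((trivializationAt F E x).continuousLinearEquivAt ℝ x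
    (FiberBundle.mem_baseSet_trivializationAt' x)).toLinearEquiv.finrank_eq

variable (F E) in
theorem nontrivial_fibre [Nontrivial F] (x : M) : Nontrivial (E x) :=
  ((trivializationAt F E x).continuousLinearEquivAt ℝ x
    (FiberBundle.mem_baseSet_trivializationAt' x)).toEquiv.nontrivial

variable {EM : Type*} [NormedAddCommGroup EM] [NormedSpace ℝ EM]
  {H : Type*} [TopologicalSpace H] {I : ModelWithCorners ℝ EM H} [ChartedSpace H M]

theorem contMDiff_totalSpaceMk (x : M) :
    ContMDiff 𝓘(ℝ, E x) (I.prod 𝓘(ℝ, F)) ∞ (fun y : E x ↦ (⟨x, y⟩ : TotalSpace F E)) := by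
  intro y
  rw [contMDiffAt_totalSpace]
  refine ⟨contMDiffAt_const, ?_⟩
  have hcoord : (fun y : E x ↦ (trivializationAt F E x ⟨x, y⟩).2) =
      (trivializationAt F E x).continuousLinearMapAt ℝ x := by
    ext y
    rw [Trivialization.continuousLinearMapAt_apply, Trivialization.linearMapAt_apply,
      if_pos (FiberBundle.mem_baseSet_trivializationAt' x)]
  exact hcoord ▸ ((trivializationAt F E x).continuousLinearMapAt ℝ x).contMDiff.contMDiffAt

end Fibres

namespace RadialGraph

section Basic

variable {EM : Type*} [NormedAddCommGroup EM] [NormedSpace ℝ EM]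
  {H : Type*} [TopologicalSpace H] {I : ModelWithCorners ℝ EM H}
  {M : Type*} [TopologicalSpace M] [ChartedSpace H M]
  {F : Type*} [NormedAddCommGroup F] [NormedSpace ℝ F]
  {E : M → Type*} [TopologicalSpace (TotalSpace F E)]
  [∀ x, NormedAddCommGroup (E x)] [∀ x, InnerProductSpace ℝ (E x)]
  [FiberBundle F E] {Y Z : RadialGraph I F E} {ξ : TotalSpace F E}

theorem definingFunction_of_snd_eq_zero (hξ : ξ.snd = 0) : Y.definingFunction ξ = 0 := by
  rw [definingFunction, hξ, norm_zero, zero_mul]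

theorem definingFunction_pos (Y : RadialGraph I F E) (hξ : ξ ∈ puncturedBundle F E) :
    0 < Y.definingFunction ξ :=
  mul_pos (norm_pos_iff.2 hξ) (Real.exp_pos _)

theorem definingFunction_dilate (Y : RadialGraph I F E) {c : ℝ} (hc : 0 < c)
    (ξ : TotalSpace F E) : Y.definingFunction (dilate c ξ) = c * Y.definingFunction ξ := by
  by_cases hξ : ξ ∈ puncturedBundle F E
  · rw [definingFunction, definingFunction, norm_dilate, radialExtension_dilate _ hc hξ,
      abs_of_pos hc, mul_assoc]
  · have hξ0 : ξ.snd = 0 := not_not.1 hξ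
    rw [definingFunction, definingFunction, norm_dilate, hξ0, norm_zero, mul_zero, zero_mul,
      zero_mul, mul_zero]

theorem mem_puncturedBundle_of_mem_carrier (hξ : ξ ∈ Y.carrier) : ξ ∈ puncturedBundle F E := by
  rw [carrier_eq] at hξ
  exact hξ.1

theorem mem_carrier_iff : ξ ∈ Y.carrier ↔ Y.definingFunction ξ = 1 := by
  rw [carrier_eq]
  refine and_iff_right_of_imp fun hξ h0 ↦ ?_
  rw [definingFunction_of_snd_eq_zero h0] at hξ
  exact zero_ne_one hξ

theorem homothetic_iff :
    Y.Homothetic Z ↔ ∃ c > 0, ∀ ξ, Y.definingFunction ξ = c * Z.definingFunction ξ := by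
  constructor
  · rintro ⟨c, hc, hYZ⟩
    refine ⟨c, hc, fun ξ ↦ ?_⟩
    by_cases hξ : ξ ∈ puncturedBundle F E
    · have hpos := Y.definingFunction_pos hξ
      have hY : dilate (Y.definingFunction ξ)⁻¹ ξ ∈ Y.carrier := by
        rw [mem_carrier_iff, definingFunction_dilate _ (by positivity), inv_mul_cancel₀ hpos.ne']
      have hZ : dilate c (dilate (Y.definingFunction ξ)⁻¹ ξ) ∈ Z.carrier :=
        hYZ ▸ Set.mem_image_of_mem _ hY
      rw [mem_carrier_iff, definingFunction_dilate _ hc,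
        definingFunction_dilate _ (by positivity)] at hZ
      field_simp at hZ
      exact hZ.symm
    · have hξ0 : ξ.snd = 0 := not_not.1 hξ
      rw [definingFunction_of_snd_eq_zero hξ0, definingFunction_of_snd_eq_zero hξ0, mul_zero]
  · rintro ⟨c, hc, hYZ⟩
    refine ⟨c, hc, Set.ext fun ξ ↦ ⟨fun hξ ↦ ⟨dilate c⁻¹ ξ, ?_, ?_⟩, ?_⟩⟩
    · rw [mem_carrier_iff, definingFunction_dilate _ (by positivity), hYZ, mem_carrier_iff.1 hξ,
        mul_one, inv_mul_cancel₀ hc.ne']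
    · rw [dilate_dilate, mul_inv_cancel₀ hc.ne', dilate_one]
    · rintro ⟨η, hη, rfl⟩
      rw [mem_carrier_iff, definingFunction_dilate _ hc, ← hYZ, mem_carrier_iff.1 hη]

theorem isC2Gauge [VectorBundle ℝ F E] (Y : RadialGraph I F E) (x : M) :
    IsC2Gauge fun y : E x ↦ Y.definingFunction ⟨x, y⟩ where
  contDiffAt p hp := by
    have hext : ContMDiffOn 𝓘(ℝ, E x) 𝓘(ℝ, ℝ) ∞
        (fun y : E x ↦ radialExtension Y.logRadius ⟨x, y⟩) {0}ᶜ :=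
      Y.smooth.comp (contMDiff_totalSpaceMk x).contMDiffOn fun y hy ↦ hy
    have hext2 : ContDiffAt ℝ 2 (fun y : E x ↦ radialExtension Y.logRadius ⟨x, y⟩) p :=
      (hext.contDiffOn.contDiffAt (isOpen_ne.mem_nhds hp)).of_le ENat.LEInfty.out
    exact (contDiffAt_norm ℝ hp).mul hext2.neg.exp
  pos p hp := Y.definingFunction_pos hp
  homog c hc p _ := Y.definingFunction_dilate hc ⟨x, p⟩

/-- The radial graph over the unit sphere bundle whose part in each fibre is a sphere about the
origin, the logarithm of the radius being a function on the base. -/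
def ofBase (w : M → ℝ) (hw : CMDiff ∞ w) : RadialGraph I F E where
  logRadius ξ := w (ξ : TotalSpace F E).proj
  smooth := (hw.comp (contMDiff_proj E)).contMDiffOn.congr fun ξ hξ ↦ by
    rw [radialExtension, dif_pos hξ]
    rfl

theorem definingFunction_ofBase (w : M → ℝ) (hw : CMDiff ∞ w) :
    (ofBase w hw : RadialGraph I F E).definingFunction =
      fun ξ ↦ Real.exp (-w ξ.proj) * ‖ξ.snd‖ := by
  ext ξ
  by_cases hξ : ξ ∈ puncturedBundle F E
  · rw [definingFunction, radialExtension, dif_pos hξ, mul_comm]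
    rfl
  · have hξ0 : ξ.snd = 0 := not_not.1 hξ
    rw [definingFunction_of_snd_eq_zero hξ0, hξ0, norm_zero, mul_zero]

theorem mem_carrier_ofBase_iff {w : M → ℝ} {hw : CMDiff ∞ w} :
    ξ ∈ (ofBase w hw : RadialGraph I F E).carrier ↔ ‖ξ.snd‖ = Real.exp (w ξ.proj) := by
  simp only [mem_carrier_iff, definingFunction_ofBase]
  rw [Real.exp_neg, inv_mul_eq_one₀ (Real.exp_ne_zero _), eq_comm]

theorem sub_eq_sub_of_homothetic_ofBase [∀ x, Nontrivial (E x)] {w₁ w₂ : M → ℝ}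
    {hw₁ : CMDiff ∞ w₁} {hw₂ : CMDiff ∞ w₂}
    (h : (ofBase w₁ hw₁ : RadialGraph I F E).Homothetic (ofBase w₂ hw₂)) (x y : M) :
    w₂ x - w₁ x = w₂ y - w₁ y := by
  obtain ⟨c, hc, hdef⟩ := homothetic_iff.1 h
  have hlog (z : M) : w₂ z - w₁ z = Real.log c := by
    obtain ⟨e, he⟩ := exists_norm_eq (E z) zero_le_one
    have hexp := hdef ⟨z, e⟩
    simp only [definingFunction_ofBase, he, mul_one] at hexp
    have hlogexp := congrArg Real.log hexp
    rw [Real.log_mul hc.ne' (Real.exp_ne_zero _), Real.log_exp, Real.log_exp] at hlogexp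
    linarith
  rw [hlog, hlog]

end Basic

section Curvature

variable {EM : Type*} [NormedAddCommGroup EM] [NormedSpace ℝ EM]
  {H : Type*} [TopologicalSpace H] {I : ModelWithCorners ℝ EM H}
  {M : Type*} [TopologicalSpace M] [ChartedSpace H M]
  {F : Type*} [NormedAddCommGroup F] [NormedSpace ℝ F] [FiniteDimensional ℝ F]
  {E : M → Type*} [TopologicalSpace (TotalSpace F E)]
  [∀ x, NormedAddCommGroup (E x)] [∀ x, InnerProductSpace ℝ (E x)]
  [FiberBundle F E] [VectorBundle ℝ F E] {Y : RadialGraph I F E} {K : TotalSpace F E → ℝ}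

theorem hasVerticalGaussCurvature_ofBase {w : M → ℝ} (hw : CMDiff ∞ w)
    (hK : ∀ ξ : TotalSpace F E, ‖ξ.snd‖ = Real.exp (w ξ.proj) →
      K ξ = ‖ξ.snd‖⁻¹ ^ (Module.finrank ℝ F - 1)) :
    (ofBase w hw : RadialGraph I F E).HasVerticalGaussCurvature K := by
  intro ξ hξ
  have : FiniteDimensional ℝ (E ξ.proj) := fibre_finiteDimensional F E ξ.proj
  have : CompleteSpace (E ξ.proj) := fibre_completeSpace F E ξ.proj
  have hξ0 : ξ.snd ≠ 0 := mem_puncturedBundle_of_mem_carrier hξ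
  rw [hK ξ (mem_carrier_ofBase_iff.1 hξ), verticalGaussCurvature, definingFunction_ofBase,
    ← finrank_fibre F E ξ.proj,
    gaussCurvature_const_mul_norm (Real.exp_pos (-w ξ.proj)) hξ0]

theorem one_lt_rank_fibre (hF : 2 ≤ Module.finrank ℝ F) (x : M) : 1 < Module.rank ℝ (E x) := by
  have := fibre_finiteDimensional F E x
  rw [← Module.finrank_eq_rank, finrank_fibre F E]
  exact_mod_cast hF

theorem exists_apply_eq_inv_pow (hF : 2 ≤ Module.finrank ℝ F) (hY : Y.HasVerticalGaussCurvature K)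
    {k : ℝ → ℝ} (hk : ContinuousOn k (Set.Ioi 0))
    (hKk : ∀ ξ ∈ puncturedBundle F E, K ξ = k ‖ξ.snd‖) (x : M) :
    ∃ r > 0, k r = r⁻¹ ^ (Module.finrank ℝ F - 1) := by
  have := fibre_finiteDimensional F E x
  have := fibre_completeSpace F E x
  rw [← finrank_fibre F E x]
  refine (Y.isC2Gauge x).exists_apply_eq_inv_pow (one_lt_rank_fibre (F := F) hF x) hk
    fun p hp hp1 ↦ ?_
  rw [← hKk ⟨x, p⟩ hp, ← hY ⟨x, p⟩ (mem_carrier_iff.2 hp1), verticalGaussCurvature]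

theorem exists_definingFunction_eq_mul_norm (hF : 2 ≤ Module.finrank ℝ F)
    (hY : ∀ ξ ∈ Y.carrier, ‖ξ.snd‖⁻¹ ^ (Module.finrank ℝ F - 1) ≤ Y.verticalGaussCurvature ξ) :
    ∃ h : M → ℝ, (∀ x, 0 < h x) ∧ Y.definingFunction = fun ξ ↦ h ξ.proj * ‖ξ.snd‖ := by
  have hfibre (x : M) : ∃ c > 0, ∀ p : E x, p ≠ 0 → Y.definingFunction ⟨x, p⟩ = c * ‖p‖ := by
    have := fibre_finiteDimensional F E x
    have := fibre_completeSpace F E x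
    refine (Y.isC2Gauge x).exists_eq_const_mul_norm (one_lt_rank_fibre (F := F) hF x)
      fun p _ hp1 ↦ ?_
    rw [finrank_fibre F E x]
    exact hY ⟨x, p⟩ (mem_carrier_iff.2 hp1)
  choose h hpos hh using hfibre
  refine ⟨h, hpos, funext fun ξ ↦ ?_⟩
  by_cases hξ : ξ.snd = 0
  · rw [definingFunction_of_snd_eq_zero hξ, hξ, norm_zero, mul_zero]
  · exact hh ξ.proj ξ.snd hξ

end Curvature

section Convex

variable {EM : Type*} [NormedAddCommGroup EM] [NormedSpace ℝ EM]
  {H : Type*} [TopologicalSpace H] {I : ModelWithCorners ℝ EM H}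
  {M : Type*} [TopologicalSpace M] [ChartedSpace H M]
  {F : Type*} [NormedAddCommGroup F] [NormedSpace ℝ F]
  {E : M → Type*} [TopologicalSpace (TotalSpace F E)]
  [∀ x, NormedAddCommGroup (E x)] [∀ x, InnerProductSpace ℝ (E x)]
  [FiberBundle F E] [VectorBundle ℝ F E] [IsContMDiffRiemannianBundle I ∞ F E]
  {cov : CovariantDerivative I F E} {Y Z : RadialGraph I F E} {h : M → ℝ}

theorem contMDiff_of_definingFunction_eq [∀ x, Nontrivial (E x)]
    (hY : Y.definingFunction = fun ξ ↦ h ξ.proj * ‖ξ.snd‖) : CMDiff ∞ h := by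
  intro x
  obtain ⟨e, he⟩ := exists_ne (0 : E x)
  set σ : Π x, E x := FiberBundle.extend F e
  have hσ : CMDiffAt ∞ (T% σ) x := FiberBundle.contMDiffAt_extend I F e
  have hσe : σ x = e := FiberBundle.extend_apply_self ..
  have hσx : σ x ≠ 0 := hσe ▸ he
  have hne : ∀ᶠ y in 𝓝 x, σ y ≠ 0 :=
    eventually_ne_zero_section (hσ.mdifferentiableAt (by simp)) hσx
  have hext : CMDiffAt ∞ (radialExtension Y.logRadius ∘ T% σ) x :=
    (ContMDiffWithinAt.comp (s := {y | σ y ≠ 0}) x (Y.smooth ⟨x, σ x⟩ hσx) hσ.contMDiffWithinAt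
      fun y hy ↦ hy).contMDiffAt hne
  have hexp : CMDiffAt ∞ (fun y ↦ Real.exp (-radialExtension Y.logRadius ⟨y, σ y⟩)) x :=
    (Real.contDiff_exp.comp contDiff_neg).contDiffAt.contMDiffAt.comp x hext
  refine hexp.congr_of_eventuallyEq ?_
  filter_upwards [hne] with y hy
  have hYy := congrFun hY ⟨y, σ y⟩
  rw [definingFunction, mul_comm] at hYy
  exact (mul_right_cancel₀ (norm_ne_zero_iff.2 hy) hYy).symm

variable [FiniteDimensional ℝ EM] [IsManifold I ∞ M]
  [RiemannianBundle (fun x : M ↦ TangentSpace I x)]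
  [FiniteDimensional ℝ F] [ContMDiffVectorBundle ∞ F E I]

theorem isConvex_ofBase_const (hcov : cov.IsMetricCompatible) (a : ℝ) :
    (ofBase (fun _ ↦ a) contMDiff_const : RadialGraph I F E).IsConvex cov := by
  intro ξ hξ A _
  rw [definingFunction_ofBase]
  exact div_nonneg (sasakiHessian_const_mul_norm_nonneg hcov (Real.exp_pos _).le
    (mem_puncturedBundle_of_mem_carrier hξ) A) (Real.sqrt_nonneg _)

/- Along the tangent vector over `v` whose vertical part is radial, the second fundamental form is
the Hessian of `h` at `v` minus `2 (dh v) ^ 2 / h`, up to a positive factor. -/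
theorem hessian_nonneg_of_isConvex [∀ x, Nontrivial (E x)] (hcov : cov.IsMetricCompatible)
    (hconv : Y.IsConvex cov) (hpos : ∀ x, 0 < h x)
    (hY : Y.definingFunction = fun ξ ↦ h ξ.proj * ‖ξ.snd‖) (x : M) (v : TangentSpace I x) :
    0 ≤ hessian I h (FiberBundle.extend EM v) (FiberBundle.extend EM v) x := by
  have hh : CMDiff 2 h := (contMDiff_of_definingFunction_eq hY).of_le ENat.LEInfty.out
  obtain ⟨p, hp⟩ := exists_norm_eq (E x) (inv_pos.2 (hpos x)).le
  have hpn : 0 < ‖p‖ := hp ▸ inv_pos.2 (hpos x)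
  have hξ : (⟨x, p⟩ : TotalSpace F E) ∈ puncturedBundle F E := norm_pos_iff.1 hpn
  have hcarrier : (⟨x, p⟩ : TotalSpace F E) ∈ Y.carrier := by
    simp only [mem_carrier_iff, hY, hp, mul_inv_cancel₀ (hpos x).ne']
  have hderiv (v : TangentSpace I x) (a : ℝ) : sasakiDeriv cov Y.definingFunction ⟨x, p⟩
      (v, a • p) = ‖p‖ * (mvfderiv I h x v + a * h x) := by
    rw [hY]
    exact sasakiDeriv_mul_norm_smul_self hcov (hh.mdifferentiable two_ne_zero x) hξ v a
  have hvert : verticalDeriv Y.definingFunction ⟨x, p⟩ ≠ 0 := by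
    intro hzero
    have hradial := hderiv 0 1
    rw [sasakiDeriv, hzero] at hradial
    simp only [map_zero, zero_apply, add_zero, zero_add, one_mul] at hradial
    exact (mul_pos hpn (hpos x)).ne hradial
  have hform := hconv ⟨x, p⟩ hcarrier (v, -(mvfderiv I h x v / h x) • p) (by
    rw [hderiv, neg_mul, div_mul_cancel₀ _ (hpos x).ne', add_neg_cancel, mul_zero])
  rw [sasakiSecondFundamentalForm, le_div_iff₀ (sasakiGradNorm_pos hvert), zero_mul, hY,
    sasakiHessian_mul_norm_smul_self hcov hh hξ] at hform
  have hsum := nonneg_of_mul_nonneg_right hform hpn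
  have hsq : 0 ≤ mvfderiv I h x v ^ 2 / h x := div_nonneg (sq_nonneg _) (hpos x).le
  linear_combination hsum + 2 * hsq

theorem exists_definingFunction_eq_const_mul_norm [I.Boundaryless] [CompactSpace M]
    [ConnectedSpace M] [IsContMDiffRiemannianBundle I ∞ EM (fun x : M ↦ TangentSpace I x)]
    (hF : 2 ≤ Module.finrank ℝ F) (hcov : cov.IsMetricCompatible) (hconv : Y.IsConvex cov)
    (hY : ∀ ξ ∈ Y.carrier, ‖ξ.snd‖⁻¹ ^ (Module.finrank ℝ F - 1) ≤ Y.verticalGaussCurvature ξ) :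
    ∃ c > 0, Y.definingFunction = fun ξ ↦ c * ‖ξ.snd‖ := by
  have : Nontrivial F := Module.nontrivial_of_finrank_pos (R := ℝ) (by lia)
  have := nontrivial_fibre F E
  obtain ⟨h, hpos, hdef⟩ := exists_definingFunction_eq_mul_norm hF hY
  have hsmooth : CMDiff ∞ h := contMDiff_of_definingFunction_eq hdef
  obtain ⟨x₀⟩ := ‹ConnectedSpace M›.toNonempty
  refine ⟨h x₀, hpos x₀, hdef.trans (funext fun ξ ↦ ?_)⟩
  rw [eq_of_hessian_nonneg (hsmooth.of_le ENat.LEInfty.out)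
    (hessian_nonneg_of_isConvex hcov hconv hpos hdef) ξ.proj x₀]

theorem homothetic_of_isConvex [I.Boundaryless] [CompactSpace M] [ConnectedSpace M]
    [IsContMDiffRiemannianBundle I ∞ EM (fun x : M ↦ TangentSpace I x)]
    (hF : 2 ≤ Module.finrank ℝ F) (hcov : cov.IsMetricCompatible)
    (hYconv : Y.IsConvex cov)
    (hY : ∀ ξ ∈ Y.carrier, ‖ξ.snd‖⁻¹ ^ (Module.finrank ℝ F - 1) ≤ Y.verticalGaussCurvature ξ)
    (hZconv : Z.IsConvex cov)
    (hZ : ∀ ξ ∈ Z.carrier, ‖ξ.snd‖⁻¹ ^ (Module.finrank ℝ F - 1) ≤ Z.verticalGaussCurvature ξ) :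
    Y.Homothetic Z := by
  obtain ⟨c, hc, hYc⟩ := exists_definingFunction_eq_const_mul_norm hF hcov hYconv hY
  obtain ⟨d, hd, hZd⟩ := exists_definingFunction_eq_const_mul_norm hF hcov hZconv hZ
  refine homothetic_iff.2 ⟨c / d, by positivity, fun ξ ↦ ?_⟩
  rw [hYc, hZd, ← mul_assoc, div_mul_cancel₀ c hd.ne']

end Convex

end RadialGraph

section Existence

theorem nontrivial_of_finrank_model_pos {EM : Type*} [NormedAddCommGroup EM] [NormedSpace ℝ EM]
    {H : Type*} [TopologicalSpace H] (I : ModelWithCorners ℝ EM H) [I.Boundaryless]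
    (M : Type*) [TopologicalSpace M] [Nonempty M] [ChartedSpace H M]
    (h : 0 < Module.finrank ℝ EM) : Nontrivial M := by
  obtain ⟨x⟩ := ‹Nonempty M›
  have : Nontrivial EM := Module.nontrivial_of_finrank_pos h
  by_contra hM
  rw [not_nontrivial_iff_subsingleton] at hM
  have htarget : (extChartAt I x).target = {extChartAt I x x} := by
    refine Set.eq_singleton_iff_unique_mem.2 ⟨mem_extChartAt_target x, fun y hy ↦ ?_⟩
    rw [← (extChartAt I x).right_inv hy, Subsingleton.elim ((extChartAt I x).symm y) x]
  exact not_isOpen_singleton _ (htarget ▸ isOpen_extChartAt_target x)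

theorem exists_contMDiff_ne {EM : Type*} [NormedAddCommGroup EM] [NormedSpace ℝ EM]
    [FiniteDimensional ℝ EM] {H : Type*} [TopologicalSpace H] (I : ModelWithCorners ℝ EM H)
    {M : Type*} [TopologicalSpace M] [T2Space M] [SigmaCompactSpace M]
    [ChartedSpace H M] [IsManifold I ∞ M] {x y : M} (hxy : x ≠ y) :
    ∃ w : M → ℝ, CMDiff ∞ w ∧ w x ≠ w y := by
  obtain ⟨w, hwx, hwy, -⟩ := exists_contMDiffMap_zero_one_of_isClosed I (n := ⊤)
    isClosed_singleton isClosed_singleton (Set.disjoint_singleton.2 hxy)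
  exact ⟨w, w.contMDiff, by rw [hwx rfl, hwy rfl]; exact zero_ne_one⟩

theorem inv_pow_eq_zpow_one_sub (r : ℝ) {m : ℕ} (hm : 1 ≤ m) :
    r⁻¹ ^ (m - 1) = r ^ (1 - (m : ℤ)) := by
  rw [inv_pow, ← zpow_natCast, ← zpow_neg]
  congr 1
  lia

variable {EM : Type*} [NormedAddCommGroup EM] [NormedSpace ℝ EM] [FiniteDimensional ℝ EM]
  {H : Type*} [TopologicalSpace H] {I : ModelWithCorners ℝ EM H}
  {M : Type*} [TopologicalSpace M] [ChartedSpace H M] [IsManifold I ∞ M]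
  {F : Type*} [NormedAddCommGroup F] [NormedSpace ℝ F] [FiniteDimensional ℝ F]
  {E : M → Type*} [TopologicalSpace (TotalSpace F E)]
  [∀ x, NormedAddCommGroup (E x)] [∀ x, InnerProductSpace ℝ (E x)]
  [FiberBundle F E] [VectorBundle ℝ F E] {K : TotalSpace F E → ℝ}

namespace RadialGraph

theorem exists_isConvex [RiemannianBundle (fun x : M ↦ TangentSpace I x)]
    [ContMDiffVectorBundle ∞ F E I] [IsContMDiffRiemannianBundle I ∞ F E]
    {cov : CovariantDerivative I F E} (hcov : cov.IsMetricCompatible) {r : ℝ} (hr : 0 < r)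
    (hK : ∀ ξ : TotalSpace F E, ‖ξ.snd‖ = r → K ξ = r⁻¹ ^ (Module.finrank ℝ F - 1)) :
    ∃ Y : RadialGraph I F E, Y.HasVerticalGaussCurvature K ∧ Y.IsConvex cov := by
  refine ⟨ofBase (fun _ ↦ Real.log r) contMDiff_const,
    hasVerticalGaussCurvature_ofBase _ fun ξ hξ ↦ ?_, isConvex_ofBase_const hcov _⟩
  rw [Real.exp_log hr] at hξ
  rw [hK ξ hξ, hξ]

theorem exists_pairwise_not_homothetic [T2Space M] [SigmaCompactSpace M] [Nontrivial M]
    [∀ x, Nontrivial (E x)]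
    (hK : ∀ ξ ∈ puncturedBundle F E, K ξ = ‖ξ.snd‖⁻¹ ^ (Module.finrank ℝ F - 1)) :
    ∃ Y : ℕ → RadialGraph I F E, (∀ i, (Y i).HasVerticalGaussCurvature K) ∧
      ∀ i j, i ≠ j → ¬ (Y i).Homothetic (Y j) := by
  obtain ⟨x, y, hxy⟩ := exists_pair_ne M
  obtain ⟨w, hw, hwxy⟩ := exists_contMDiff_ne I hxy
  refine ⟨fun i ↦ ofBase (fun z ↦ (i : ℝ) * w z) (contMDiff_const.mul hw),
    fun i ↦ hasVerticalGaussCurvature_ofBase _ fun ξ hξ ↦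
      hK ξ (norm_pos_iff.1 (hξ ▸ Real.exp_pos _)), fun i j hij h ↦ ?_⟩
  have hsub := sub_eq_sub_of_homothetic_ofBase h x y
  rw [← sub_mul, ← sub_mul] at hsub
  exact hwxy (mul_left_cancel₀ (sub_ne_zero.2 (Nat.cast_injective.ne hij.symm)) hsub)

end RadialGraph

end Existence

end

theorem theorem2_general
    {EM : Type*} [NormedAddCommGroup EM] [NormedSpace ℝ EM] [FiniteDimensional ℝ EM]
    {H : Type*} [TopologicalSpace H] {I : ModelWithCorners ℝ EM H} [I.Boundaryless]
    {M : Type*} [TopologicalSpace M] [T2Space M] [CompactSpace M] [Nonempty M]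
    [ChartedSpace H M] [IsManifold I ∞ M]
    [RiemannianBundle (fun x : M ↦ TangentSpace I x)]
    [IsContMDiffRiemannianBundle I ∞ EM (fun x : M ↦ TangentSpace I x)]
    {F : Type*} [NormedAddCommGroup F] [NormedSpace ℝ F] [FiniteDimensional ℝ F]
    {E : M → Type*} [TopologicalSpace (TotalSpace F E)]
    [∀ x, NormedAddCommGroup (E x)] [∀ x, InnerProductSpace ℝ (E x)]
    [FiberBundle F E] [VectorBundle ℝ F E] [ContMDiffVectorBundle ∞ F E I]
    [IsContMDiffRiemannianBundle I ∞ F E]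
    (cov : CovariantDerivative I F E) (hcov : cov.IsMetricCompatible)
    (hEM : 1 ≤ Module.finrank ℝ EM) (hF : 2 ≤ Module.finrank ℝ F)
    (K : TotalSpace F E → ℝ) (hK : ContinuousOn K (puncturedBundle F E))
    (hKrad : ∃ k : ℝ → ℝ, ∀ ξ ∈ puncturedBundle F E, K ξ = k ‖ξ.snd‖) :
    ((∃ r : ℝ, 0 < r ∧ ∀ ξ ∈ unitSphereBundle F E,
        K (dilate r ξ) = r ^ (1 - (Module.finrank ℝ F : ℤ))) →
      ∃ Y : RadialGraph I F E, Y.HasVerticalGaussCurvature K ∧ Y.IsConvex cov) ∧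
    ((∃ Y : RadialGraph I F E, Y.HasVerticalGaussCurvature K) →
      ∃ r : ℝ, 0 < r ∧ ∀ ξ ∈ unitSphereBundle F E,
        K (dilate r ξ) = r ^ (1 - (Module.finrank ℝ F : ℤ))) ∧
    ((∀ r : ℝ, 0 < r → ∀ ξ ∈ unitSphereBundle F E,
        K (dilate r ξ) = r ^ (1 - (Module.finrank ℝ F : ℤ))) →
      (∃ Y : ℕ → RadialGraph I F E, (∀ i, (Y i).HasVerticalGaussCurvature K) ∧
        ∀ i j, i ≠ j → ¬ (Y i).Homothetic (Y j)) ∧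
      (∃ Y : RadialGraph I F E, Y.HasVerticalGaussCurvature K ∧ Y.IsConvex cov) ∧
      (ConnectedSpace M → ∀ Y Z : RadialGraph I F E,
        Y.HasVerticalGaussCurvature K → Y.IsConvex cov →
        Z.HasVerticalGaussCurvature K → Z.IsConvex cov → Y.Homothetic Z)) := by
  have : Nontrivial F := Module.nontrivial_of_finrank_pos (R := ℝ) (by lia)
  have := nontrivial_fibre F E
  simp only [← inv_pow_eq_zpow_one_sub _ (one_le_two.trans hF)]
  have hconvex : (∃ r : ℝ, 0 < r ∧ ∀ ξ ∈ unitSphereBundle F E,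
      K (dilate r ξ) = r⁻¹ ^ (Module.finrank ℝ F - 1)) →
      ∃ Y : RadialGraph I F E, Y.HasVerticalGaussCurvature K ∧ Y.IsConvex cov :=
    fun ⟨_, hr, hKr⟩ ↦ RadialGraph.exists_isConvex hcov hr fun _ ↦ apply_eq_of_norm_eq hr hKr
  refine ⟨hconvex, fun ⟨Y, hY⟩ ↦ ?_, fun hKr ↦ ?_⟩
  · obtain ⟨k, hk⟩ := hKrad
    obtain ⟨x⟩ := ‹Nonempty M›
    obtain ⟨r, hr, hkr⟩ := RadialGraph.exists_apply_eq_inv_pow hF hY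
      (continuousOn_of_forall_apply_eq_norm (x := x) hK hk) hk x
    exact ⟨r, hr, fun ξ hξ ↦ hkr ▸ apply_dilate_eq hr hk hξ⟩
  · have hKpow (ξ) (hξ : ξ ∈ puncturedBundle F E) :
        K ξ = ‖ξ.snd‖⁻¹ ^ (Module.finrank ℝ F - 1) :=
      apply_eq_of_norm_eq (norm_pos_iff.2 hξ) (hKr _ (norm_pos_iff.2 hξ)) rfl
    have hcurv {Y : RadialGraph I F E} (hY : Y.HasVerticalGaussCurvature K) (ξ)
        (hξ : ξ ∈ Y.carrier) :
        ‖ξ.snd‖⁻¹ ^ (Module.finrank ℝ F - 1) ≤ Y.verticalGaussCurvature ξ :=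
      ((hY ξ hξ).trans (hKpow ξ (RadialGraph.mem_puncturedBundle_of_mem_carrier hξ))).ge
    have := nontrivial_of_finrank_model_pos I M hEM
    exact ⟨RadialGraph.exists_pairwise_not_homothetic hKpow, hconvex ⟨1, one_pos, hKr 1 one_pos⟩,
      fun _ Y Z hY hYconv hZ hZconv ↦
        RadialGraph.homothetic_of_isConvex hF hcov hYconv (hcurv hY) hZconv (hcurv hZ)⟩

theorem theorem2
    -- a closed smooth manifold of dimension at least one with a Riemannian metric
    {EM : Type*} [NormedAddCommGroup EM] [NormedSpace ℝ EM] [FiniteDimensional ℝ EM]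
    {H : Type*} [TopologicalSpace H] {I : ModelWithCorners ℝ EM H} [I.Boundaryless]
    {M : Type*} [TopologicalSpace M] [T2Space M] [CompactSpace M] [Nonempty M]
    [ChartedSpace H M] [IsManifold I ∞ M]
    [RiemannianBundle (fun x : M ↦ TangentSpace I x)]
    [IsContMDiffRiemannianBundle I ∞ EM (fun x : M ↦ TangentSpace I x)]
    -- a smooth Riemannian vector bundle of rank at least two
    {F : Type*} [NormedAddCommGroup F] [NormedSpace ℝ F] [FiniteDimensional ℝ F]
    {E : M → Type*} [TopologicalSpace (TotalSpace F E)]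
    [∀ x, NormedAddCommGroup (E x)] [∀ x, InnerProductSpace ℝ (E x)]
    [FiberBundle F E] [VectorBundle ℝ F E] [ContMDiffVectorBundle ∞ F E I]
    [IsContMDiffRiemannianBundle I ∞ F E]
    -- a smooth metric connection on it
    (cov : CovariantDerivative I F E) [cov.ContMDiffCovariantDerivative ∞]
    (hcov : cov.IsMetricCompatible)
    {n m : ℕ} (hn : Module.finrank ℝ EM = n) (hn1 : 1 ≤ n)
    (hm : Module.finrank ℝ F = m) (hm2 : 2 ≤ m)
    -- a smooth positive radial function on the punctured bundle
    (K : TotalSpace F E → ℝ)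
    (hK : ContMDiffOn (I.prod 𝓘(ℝ, F)) 𝓘(ℝ, ℝ) ∞ K (puncturedBundle F E))
    (hKpos : ∀ ξ ∈ puncturedBundle F E, 0 < K ξ)
    (hKrad : ∃ k : ℝ → ℝ, ∀ ξ ∈ puncturedBundle F E, K ξ = k ‖ξ.snd‖) :
    ((∃ r : ℝ, 0 < r ∧ ∀ ξ ∈ unitSphereBundle F E, K (dilate r ξ) = r ^ (1 - (m : ℤ))) →
      ∃ Y : RadialGraph I F E, Y.HasVerticalGaussCurvature K ∧ Y.IsConvex cov) ∧
    ((∃ Y : RadialGraph I F E, Y.HasVerticalGaussCurvature K) →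
      ∃ r : ℝ, 0 < r ∧ ∀ ξ ∈ unitSphereBundle F E, K (dilate r ξ) = r ^ (1 - (m : ℤ))) ∧
    ((∀ r : ℝ, 0 < r → ∀ ξ ∈ unitSphereBundle F E, K (dilate r ξ) = r ^ (1 - (m : ℤ))) →
      (∃ Y : ℕ → RadialGraph I F E, (∀ i, (Y i).HasVerticalGaussCurvature K) ∧
        ∀ i j, i ≠ j → ¬ (Y i).Homothetic (Y j)) ∧
      (∃ Y : RadialGraph I F E, Y.HasVerticalGaussCurvature K ∧ Y.IsConvex cov) ∧
      (ConnectedSpace M → ∀ Y Z : RadialGraph I F E,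
        Y.HasVerticalGaussCurvature K → Y.IsConvex cov →
        Z.HasVerticalGaussCurvature K → Z.IsConvex cov → Y.Homothetic Z)) := by
  subst hn hm
  exact theorem2_general cov hcov hn1 hm2 K hK.continuousOn hKrad
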